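/- All Hilbert spaces are finite-dimensional; a state is a positive semidefinite operator of trace one, and a channel is a completely positive trace-preserving linear map. For a state $\rho_{ABC}$ with marginals $\rho_A,\rho_B,\rho_{AB},\rho_{BC}$ and $S(X)_\rho=-\mathrm{Tr}\,\rho_X\log_2\rho_X$, let $$I(A:C|B)_\rho=S(AB)_\rho+S(BC)_\rho-S(B)_\rho-S(ABC)_\rho,$$ $$I_1(A:C|B)_\rho=\|\rho_{ABC}-\rho_A\otimes\rho_{BC}\|_1-\|\rho_{AB}-\rho_A\otimes\rho_B\|_1$$ be the conditional mutual information (CMI) and the trace-norm CMI, where $\|X\|_1=\mathrm{Tr}\sqrt{X^\dagger X}$. Proposition. Let $\mathcal N:\mathcal B(\mathcal H)\to\mathcal B(\mathcal K\otimes\mathcal H)$ be a channel, written $\mathcal N:C\to B_1C$ with $C=\mathcal H$ and $B_1=\mathcal K$. Suppose that there are a constant $0\le\eta<1$, a forgetful channel $F$ (that is, $F[\rho]=\sigma$ for all states $\rho$, with one fixed state $\sigma$) and a channel $\mathcal N'$ such that $$\mathcal N=(1-\eta)F+\eta\,\mathcal N'.$$ (1) For all systems $A',B'$ and every state $\rho$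 on $A'B'C$, the state $\mathcal N(\rho):=(\mathrm{id}_{A'B'}\otimes\mathcal N)[\rho]$ on $A'B'B_1C$ satisfies $$I(A':C|B'B_1)_{\mathcal N(\rho)}\le\eta\,I(A':C|B')_\rho,\qquad I_1(A':C|B'B_1)_{\mathcal N(\rho)}\le\eta\,I_1(A':C|B')_\rho.$$ (2) Let $\rho_\ell$ be the state on $AB_1\cdots B_\ell C_\ell$, with $A,C_\ell\cong\mathcal H$ and $B_i\cong\mathcal K$, obtained from the maximally entangled state on $AC_0\cong\mathcal H\otimes\mathcal H$ by applying successively $\mathcal N:C_{i-1}\to B_iC_i$ for $i=1,\dots,\ell$. Then there is a constant $K$, independent of $n$, $m$ and $\ell$, such that for all integers $n,m\ge0$ and $\ell\ge n+m$ $$\bigl|I(AB_1\cdots B_n:B_{n+m+1}\cdots B_\ell C_\ell\,|\,B_{n+1}\cdots B_{n+m})_{\rho_\ell}\bigr|\le K\eta^m,$$ $$\bigl|I_1(AB_1\cdots B_n:B_{n+m+1}\cdots B_\ell C_\ell\,|\,B_{n+1}\cdots B_{n+m})_{\rho_\ell}\bigr|\le K\eta^m,$$ where $\eta^0=1$. 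-/

import Mathlib

open scoped Matrix Kronecker ComplexOrder

noncomputable section

namespace QChain

/-- A quantum state (density matrix) on the finite-dimensional Hilbert space `ℂ^n`. -/
def IsState {n : Type*} [Fintype n] (ρ : Matrix n n ℂ) : Prop :=
  ρ.PosSemidef ∧ ρ.trace = 1

/-- Partial trace over the right tensor factor. -/
def traceRight {m n : Type*} [Fintype n] (X : Matrix (m × n) (m × n) ℂ) : Matrix m m ℂ :=
  Matrix.of fun i j => ∑ k, X (i, k) (j, k)

/-- Partial trace over the left tensor factor. -/
def traceLeft {m n : Type*} [Fintype m] (X : Matrix (m × n) (m × n) ℂ) : Matrix n n ℂ :=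
  Matrix.of fun i j => ∑ k, X (k, i) (k, j)

/-- The map `id_d ⊗ Φ`, acting on operators on `ℂ^d ⊗ ℂ^m`: `Φ` is applied to each
`m × m` block. -/
def idTensor {d m n : Type*} (Φ : Matrix m m ℂ →ₗ[ℂ] Matrix n n ℂ)
    (X : Matrix (d × m) (d × m) ℂ) : Matrix (d × n) (d × n) ℂ :=
  Matrix.of fun x y => Φ (Matrix.of fun p q => X (x.1, p) (y.1, q)) x.2 y.2

/-- Complete positivity: `id_k ⊗ Φ` is positive for every `k`. -/
def IsCompletelyPositive {m n : Type*} (Φ : Matrix m m ℂ →ₗ[ℂ] Matrix n n ℂ) : Prop :=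
  ∀ (k : ℕ) (X : Matrix (Fin k × m) (Fin k × m) ℂ),
    X.PosSemidef → (idTensor Φ X).PosSemidef

/-- A quantum channel: a completely positive and trace-preserving linear map. -/
def IsChannel {m n : Type*} [Fintype m] [Fintype n]
    (Φ : Matrix m m ℂ →ₗ[ℂ] Matrix n n ℂ) : Prop :=
  IsCompletelyPositive Φ ∧ ∀ X, (Φ X).trace = X.trace

/-- A forgetful (constant) channel: it maps every state to one and the same state. -/
def IsForgetful {m n : Type*} [Fintype m] [Fintype n]
    (F : Matrix m m ℂ →ₗ[ℂ] Matrix n n ℂ) : Prop :=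
  IsChannel F ∧ ∃ σ : Matrix n n ℂ, IsState σ ∧ ∀ ρ, IsState ρ → F ρ = σ

/-- The von Neumann entropy `S(ρ) = -Tr (ρ log₂ ρ)` (with `0 log₂ 0 = 0`). -/
def entropy {n : Type*} [Fintype n] [DecidableEq n] (ρ : Matrix n n ℂ) : ℝ :=
  -(ρ * cfc (Real.logb 2) ρ).trace.re

/-- The trace norm `‖X‖₁ = Tr √(Xᴴ X)`. -/
def traceNorm {n : Type*} [Fintype n] [DecidableEq n] (X : Matrix n n ℂ) : ℝ :=
  (cfc Real.sqrt (Xᴴ * X)).trace.re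

section Tripartite

variable {a b c : Type*} [Fintype a] [Fintype b] [Fintype c]

/-- The reduced operator `ρ_A` of `ρ_ABC`. -/
def margA (ρ : Matrix (a × b × c) (a × b × c) ℂ) : Matrix a a ℂ :=
  traceRight ρ

/-- The reduced operator `ρ_BC` of `ρ_ABC`. -/
def margBC (ρ : Matrix (a × b × c) (a × b × c) ℂ) : Matrix (b × c) (b × c) ℂ :=
  traceLeft ρ

/-- The reduced operator `ρ_AB` of `ρ_ABC`. -/
def margAB (ρ : Matrix (a × b × c) (a × b × c) ℂ) : Matrix (a × b) (a × b) ℂ :=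
  traceRight (ρ.submatrix (Equiv.prodAssoc a b c) (Equiv.prodAssoc a b c))

/-- The reduced operator `ρ_B` of `ρ_ABC`. -/
def margB (ρ : Matrix (a × b × c) (a × b × c) ℂ) : Matrix b b ℂ :=
  traceRight (margBC ρ)

variable [DecidableEq a] [DecidableEq b] [DecidableEq c]

/-- The conditional mutual information
`I(A:C|B)_ρ = S(AB)_ρ + S(BC)_ρ - S(B)_ρ - S(ABC)_ρ`. -/
def cmi (ρ : Matrix (a × b × c) (a × b × c) ℂ) : ℝ :=
  entropy (margAB ρ) + entropy (margBC ρ) - entropy (margB ρ) - entropy ρ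

/-- The trace-norm conditional mutual information
`I₁(A:C|B)_ρ = ‖ρ_ABC - ρ_A ⊗ ρ_BC‖₁ - ‖ρ_AB - ρ_A ⊗ ρ_B‖₁`. -/
def cmiTraceNorm (ρ : Matrix (a × b × c) (a × b × c) ℂ) : ℝ :=
  traceNorm (ρ - margA ρ ⊗ₖ margBC ρ) - traceNorm (margAB ρ - margA ρ ⊗ₖ margB ρ)

end Tripartite

/-- Apply a map `N : C → B₁ C` to the system `C` of an operator on `A B C`; the result is an
operator on `A (B B₁) C`. -/
def applyOnC {a b h κ : Type*} (N : Matrix h h ℂ →ₗ[ℂ] Matrix (κ × h) (κ × h) ℂ)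
    (ρ : Matrix (a × b × h) (a × b × h) ℂ) :
    Matrix (a × (b × κ) × h) (a × (b × κ) × h) ℂ :=
  (idTensor N (ρ.submatrix (Equiv.prodAssoc a b h) (Equiv.prodAssoc a b h))).submatrix
    (fun x => ((x.1, x.2.1.1), (x.2.1.2, x.2.2)))
    (fun x => ((x.1, x.2.1.1), (x.2.1.2, x.2.2)))

/-- The maximally entangled state `(1/d) ∑ᵢⱼ |i i⟩⟨j j|` on `ℂ^h ⊗ ℂ^h`, `d = |h|`. -/
def maxEntangled (h : Type*) [Fintype h] [DecidableEq h] : Matrix (h × h) (h × h) ℂ :=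
  Matrix.of fun x y => if x.1 = x.2 ∧ y.1 = y.2 then (Fintype.card h : ℂ)⁻¹ else 0

/-- The chain `ρ_ℓ` on `A B₁ ⋯ B_ℓ C_ℓ`: it starts from the maximally entangled state on `A C₀`,
and in step `i + 1` the map `N : C_i → B_{i+1} C_{i+1}` acts on the last system. A basis vector
of `B₁ ⋯ B_ℓ` is a function `s : Fin ℓ → κ`, where `s i` is the index of `B_{i+1}`. -/
def chain {h κ : Type*} [Fintype h] [DecidableEq h]
    (N : Matrix h h ℂ →ₗ[ℂ] Matrix (κ × h) (κ × h) ℂ) :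
    (ℓ : ℕ) → Matrix (h × (Fin ℓ → κ) × h) (h × (Fin ℓ → κ) × h) ℂ
  | 0 => (maxEntangled h).submatrix (fun x => (x.1, x.2.2)) (fun x => (x.1, x.2.2))
  | ℓ + 1 => (applyOnC N (chain N ℓ)).submatrix
      (fun x => (x.1, (Fin.init x.2.1, x.2.1 (Fin.last ℓ)), x.2.2))
      (fun x => (x.1, (Fin.init x.2.1, x.2.1 (Fin.last ℓ)), x.2.2))

/-- The chain `ρ_ℓ` with `ℓ = n + m + r`, regrouped as an operator on the tripartite system with
parts `A B₁ ⋯ B_n`, `B_{n+1} ⋯ B_{n+m}` and `B_{n+m+1} ⋯ B_ℓ C_ℓ`. -/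
def chainTripartite {h κ : Type*} [Fintype h] [DecidableEq h]
    (N : Matrix h h ℂ →ₗ[ℂ] Matrix (κ × h) (κ × h) ℂ) (n m r : ℕ) :
    Matrix ((h × (Fin n → κ)) × (Fin m → κ) × ((Fin r → κ) × h))
      ((h × (Fin n → κ)) × (Fin m → κ) × ((Fin r → κ) × h)) ℂ :=
  (chain N (n + m + r)).submatrix
    (fun x => (x.1.1, Fin.append (Fin.append x.1.2 x.2.1) x.2.2.1, x.2.2.2))
    (fun x => (x.1.1, Fin.append (Fin.append x.1.2 x.2.1) x.2.2.1, x.2.2.2))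

end QChain

end

set_option linter.unusedSectionVars false

noncomputable section

/-! Both quantities are differences of divergences: writing `M` for the divergence of a bipartite
state from the product of its marginals, the conditional quantity is `M(A:BC) - M(A:B)`. Suppose the
divergence is jointly convex and monotone under channels. With weight `1 - η` the channel replaces
`C` by a fixed state, and what remains is made from `AB` alone, so its `M` is at most `M(A:B)`; with
weight `η` monotonicity gives at most `M(A:BC)`. The subtracted term after the step is at least
`M(A:B)`, since discarding `B₁` recovers `AB`. Hence the difference shrinks by the factor `η`
(`condDiv_idTensor_le_mul`).

For `I₁` the divergence is the trace distance. For the CMI, relative entropy is reduced to the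
resolvent divergences `⟨ρ, (L_σ + t R_ρ)⁻¹ ρ⟩`, `t > 0`. Each is a supremum of forms that are linear
in `(ρ, σ)`, which yields joint convexity (`resolventDiv_convexComb_le`); the Kadison–Schwarz
inequality yields monotonicity (`resolventDiv_channel_le`). Integrating over `0 < t < T` and
subtracting `log (1 + T)` gives the mutual information as `T → ∞` (`tendsto_integral_mutualDiv`); in
the conditional difference the logarithms cancel, so inequalities for every `t` pass to the CMI
(`cmi_le_of_condDiv_le`).

Along the chain, the `m` steps that create the conditioning sites give `η ^ m`, and all later steps
act on the `C` side only and cannot increase the quantity. The remaining constant bounds the case `m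
= 0`, where the conditioning system is trivial and `C` has the dimension of `h` for every `n`
(`cmi_le_card`, `cmiTraceNorm_le_two`). Nonnegativity handles the absolute values. -/

namespace QChain

/-! ### Channels, partial traces and the Kadison–Schwarz inequality -/

section Channels

variable {d m n k : Type*}

/-- `id_d ⊗ Φ` as a linear map. -/
def idTensorLM (d : Type*) (Φ : Matrix m m ℂ →ₗ[ℂ] Matrix n n ℂ) :
    Matrix (d × m) (d × m) ℂ →ₗ[ℂ] Matrix (d × n) (d × n) ℂ where
  toFun := idTensor Φ
  map_add' X Y := by
    ext x y
    change Φ (Matrix.of (fun p q => X (x.1, p) (y.1, q)) +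
      Matrix.of (fun p q => Y (x.1, p) (y.1, q))) x.2 y.2 = _
    rw [map_add]; rfl
  map_smul' c X := by
    ext x y
    change Φ (c • Matrix.of (fun p q => X (x.1, p) (y.1, q))) x.2 y.2 = _
    rw [map_smul]; rfl

@[simp]
lemma idTensorLM_apply (Φ : Matrix m m ℂ →ₗ[ℂ] Matrix n n ℂ) (X : Matrix (d × m) (d × m) ℂ) :
    idTensorLM d Φ X = idTensor Φ X := rfl

lemma idTensor_comp (Φ : Matrix m m ℂ →ₗ[ℂ] Matrix n n ℂ) (Ψ : Matrix n n ℂ →ₗ[ℂ] Matrix k k ℂ)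
    (X : Matrix (d × m) (d × m) ℂ) : idTensor (Ψ ∘ₗ Φ) X = idTensor Ψ (idTensor Φ X) := rfl

lemma idTensor_add_smul (Φ Ψ : Matrix m m ℂ →ₗ[ℂ] Matrix n n ℂ) (s t : ℝ)
    (X : Matrix (d × m) (d × m) ℂ) :
    idTensor (s • Φ + t • Ψ) X = s • idTensor Φ X + t • idTensor Ψ X := rfl

lemma idTensor_kronecker (Φ : Matrix m m ℂ →ₗ[ℂ] Matrix n n ℂ) (X : Matrix d d ℂ)
    (Y : Matrix m m ℂ) : idTensor Φ (X ⊗ₖ Y) = X ⊗ₖ Φ Y := by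
  ext x y
  change Φ (X x.1 y.1 • Y) x.2 y.2 = _
  rw [map_smul]; rfl

lemma traceLeft_idTensor [Fintype d] (Φ : Matrix m m ℂ →ₗ[ℂ] Matrix n n ℂ)
    (X : Matrix (d × m) (d × m) ℂ) : traceLeft (idTensor Φ X) = Φ (traceLeft X) := by
  have h : traceLeft X = ∑ i, Matrix.of fun p q => X (i, p) (i, q) := by
    ext p q
    simp [traceLeft, Matrix.sum_apply]
  rw [h, map_sum]
  ext p q
  simp [traceLeft, idTensor, Matrix.sum_apply]

lemma IsCompletelyPositive.idTensor_posSemidef {Φ : Matrix m m ℂ →ₗ[ℂ] Matrix n n ℂ}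
    (hΦ : IsCompletelyPositive Φ) [Finite d] {X : Matrix (d × m) (d × m) ℂ}
    (hX : X.PosSemidef) : (idTensor Φ X).PosSemidef := by
  obtain ⟨k, ⟨e⟩⟩ := Finite.exists_equiv_fin d
  have h := hΦ k (X.submatrix (Prod.map e.symm id) (Prod.map e.symm id)) (hX.submatrix _)
  convert h.submatrix (Prod.map e id) using 1
  ext x y
  simp [idTensor, Matrix.submatrix]

lemma IsCompletelyPositive.posSemidef {Φ : Matrix m m ℂ →ₗ[ℂ] Matrix n n ℂ}
    (hΦ : IsCompletelyPositive Φ) {X : Matrix m m ℂ} (hX : X.PosSemidef) : (Φ X).PosSemidef := by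
  have h := hΦ.idTensor_posSemidef (d := Unit) (hX.submatrix (fun x : Unit × m => x.2))
  exact h.submatrix (fun x => ((), x))

variable [Fintype d] [Fintype m] [Fintype n] [Fintype k]

lemma IsChannel.isState {Φ : Matrix m m ℂ →ₗ[ℂ] Matrix n n ℂ} (hΦ : IsChannel Φ)
    {ρ : Matrix m m ℂ} (hρ : IsState ρ) : IsState (Φ ρ) :=
  ⟨hΦ.1.posSemidef hρ.1, by rw [hΦ.2, hρ.2]⟩

lemma IsChannel.comp {Φ : Matrix m m ℂ →ₗ[ℂ] Matrix n n ℂ} {Ψ : Matrix n n ℂ →ₗ[ℂ] Matrix k k ℂ}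
    (hΨ : IsChannel Ψ) (hΦ : IsChannel Φ) : IsChannel (Ψ ∘ₗ Φ) :=
  ⟨fun k X hX => hΨ.1 k _ (hΦ.1 k X hX), fun X => by
    rw [LinearMap.comp_apply, hΨ.2, hΦ.2]⟩

lemma IsChannel.idTensorLM {Φ : Matrix m m ℂ →ₗ[ℂ] Matrix n n ℂ} (hΦ : IsChannel Φ) :
    IsChannel (idTensorLM d Φ) := by
  refine ⟨fun k X hX => ?_, fun X => ?_⟩
  · have h := hΦ.1.idTensor_posSemidef (d := Fin k × d)
      (hX.submatrix (Equiv.prodAssoc (Fin k) d m))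
    exact h.submatrix (Equiv.prodAssoc (Fin k) d n).symm
  · simp only [idTensorLM_apply, Matrix.trace, Fintype.sum_prod_type, Matrix.diag, idTensor]
    refine Finset.sum_congr rfl fun x _ => ?_
    exact hΦ.2 (Matrix.of fun p q => X (x, p) (x, q))

/-- Relabelling of the basis. -/
def reindexLM (e : m ≃ n) : Matrix m m ℂ →ₗ[ℂ] Matrix n n ℂ :=
  (Matrix.reindexLinearEquiv ℂ ℂ e e).toLinearMap

lemma reindexLM_apply (e : m ≃ n) (X : Matrix m m ℂ) (i j : n) :
    reindexLM e X i j = X (e.symm i) (e.symm j) := rfl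

lemma isChannel_reindexLM (e : m ≃ n) : IsChannel (reindexLM e) := by
  refine ⟨fun k X hX => hX.submatrix (Prod.map id e.symm), fun X => ?_⟩
  exact Equiv.sum_comp e.symm (fun i => X i i)

/-- The partial trace as a linear map. -/
def traceRightLM (m n : Type*) [Fintype n] :
    Matrix (m × n) (m × n) ℂ →ₗ[ℂ] Matrix m m ℂ where
  toFun := traceRight
  map_add' X Y := by ext; simp [traceRight, Finset.sum_add_distrib]
  map_smul' c X := by ext; simp [traceRight, Finset.mul_sum]

@[simp]
lemma traceRightLM_apply (X : Matrix (m × n) (m × n) ℂ) :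
    traceRightLM m n X = traceRight X := rfl

lemma isChannel_traceRightLM : IsChannel (traceRightLM m n) := by
  refine ⟨fun k X hX => ?_, fun X => ?_⟩
  · have h : idTensor (traceRightLM m n) X =
        ∑ i : n, X.submatrix (fun x => (x.1, x.2, i)) (fun x => (x.1, x.2, i)) := by
      ext x y
      simp [idTensor, traceRight, Matrix.sum_apply]
    rw [h]
    exact Matrix.posSemidef_sum _ fun i _ => hX.submatrix _
  · simp [Matrix.trace, traceRight, Fintype.sum_prod_type]

/-- Adjoining a fixed operator on a second system. -/
def kroneckerLM (σ : Matrix n n ℂ) : Matrix m m ℂ →ₗ[ℂ] Matrix (m × n) (m × n) ℂ where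
  toFun X := X ⊗ₖ σ
  map_add' _ _ := Matrix.add_kronecker _ _ _
  map_smul' _ _ := Matrix.smul_kronecker _ _ _

lemma isChannel_kroneckerLM {σ : Matrix n n ℂ} (hσ : IsState σ) :
    IsChannel (kroneckerLM σ : Matrix m m ℂ →ₗ[ℂ] _) := by
  refine ⟨fun k X hX => ?_, fun X => ?_⟩
  · exact (hX.kronecker hσ.1).submatrix (Equiv.prodAssoc (Fin k) m n).symm
  · change (X ⊗ₖ σ).trace = _
    rw [Matrix.trace_kronecker, hσ.2, mul_one]

lemma IsState.traceRight {ρ : Matrix (m × n) (m × n) ℂ} (hρ : IsState ρ) :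
    IsState (traceRight ρ) := isChannel_traceRightLM.isState hρ

lemma IsState.traceLeft {ρ : Matrix (m × n) (m × n) ℂ} (hρ : IsState ρ) :
    IsState (traceLeft ρ) :=
  (isChannel_traceRightLM.comp (isChannel_reindexLM (Equiv.prodComm m n))).isState hρ

lemma IsState.kronecker {ρ : Matrix m m ℂ} {σ : Matrix n n ℂ} (hρ : IsState ρ) (hσ : IsState σ) :
    IsState (ρ ⊗ₖ σ) := (isChannel_kroneckerLM hσ).isState hρ

lemma traceRight_idTensor {Φ : Matrix m m ℂ →ₗ[ℂ] Matrix n n ℂ} (hΦ : IsChannel Φ)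
    (X : Matrix (d × m) (d × m) ℂ) : traceRight (idTensor Φ X) = traceRight X := by
  ext x y
  exact hΦ.2 (Matrix.of fun p q => X (x, p) (y, q))

/-- A completely positive map sends the positive block operator `(Bᵢ σ Bⱼᴴ)ᵢⱼ` to a positive
block operator. -/
lemma IsCompletelyPositive.posSemidef_blocks {Φ : Matrix m m ℂ →ₗ[ℂ] Matrix n n ℂ}
    (hΦ : IsCompletelyPositive Φ) {σ : Matrix m m ℂ} (hσ : σ.PosSemidef)
    (B : k → Matrix m m ℂ) :
    (Matrix.of fun x y : k × n => Φ (B x.1 * σ * (B y.1)ᴴ) x.2 y.2).PosSemidef := by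
  have h := hσ.mul_mul_conjTranspose_same (Matrix.of fun (x : k × m) j => B x.1 x.2 j)
  exact hΦ.idTensor_posSemidef h

/-- The operators `Φ X` and `Φ Xᴴ` are opposite off-diagonal blocks of a positive, hence Hermitian,
block operator. -/
lemma IsCompletelyPositive.map_conjTranspose [DecidableEq m]
    {Φ : Matrix m m ℂ →ₗ[ℂ] Matrix n n ℂ} (hΦ : IsCompletelyPositive Φ) (X : Matrix m m ℂ) :
    Φ Xᴴ = (Φ X)ᴴ := by
  have h := (hΦ.posSemidef_blocks (Matrix.PosSemidef.one) ![X, 1]).isHermitian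
  ext i j
  have := congrFun (congrFun h (1, i)) (0, j)
  simpa using this.symm

lemma IsChannel.adjoint_conjTranspose [DecidableEq m] {Φ : Matrix m m ℂ →ₗ[ℂ] Matrix n n ℂ}
    (hΦ : IsChannel Φ) {Y : Matrix n n ℂ} {Z : Matrix m m ℂ}
    (hYZ : ∀ X, (Φ X * Y).trace = (X * Z).trace) (X : Matrix m m ℂ) :
    (Φ X * Yᴴ).trace = (X * Zᴴ).trace := by
  have := congrArg star (hYZ Xᴴ)
  rwa [hΦ.1.map_conjTranspose, ← Matrix.trace_conjTranspose, ← Matrix.trace_conjTranspose,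
    Matrix.conjTranspose_mul, Matrix.conjTranspose_mul, Matrix.conjTranspose_conjTranspose,
    Matrix.conjTranspose_conjTranspose, Matrix.trace_mul_comm, Matrix.trace_mul_comm Zᴴ] at this

/-- Kadison–Schwarz inequality for the adjoint `Z` of `Y` under a channel. -/
lemma IsChannel.schwarz [DecidableEq m] [DecidableEq n] {Φ : Matrix m m ℂ →ₗ[ℂ] Matrix n n ℂ}
    (hΦ : IsChannel Φ) {Y : Matrix n n ℂ} {Z : Matrix m m ℂ}
    (hYZ : ∀ X, (Φ X * Y).trace = (X * Z).trace) {σ : Matrix m m ℂ} (hσ : σ.PosSemidef) :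
    (Zᴴ * σ * Z).trace.re ≤ (Yᴴ * Φ σ * Y).trace.re := by
  have hYZ' := hΦ.adjoint_conjTranspose hYZ
  -- The blocks are `Φ` of `σ`, `-σ Z`, `-Zᴴ σ` and `Zᴴ σ Z`. Compressing with the row `(Yᴴ, 1)` and
  -- taking the trace turns each cross term into `-Tr (Zᴴ σ Z)` by duality; one of the two cancels
  -- against the last block.
  have h := hΦ.1.posSemidef_blocks hσ ![1, -Zᴴ]
  have h2 := (h.mul_mul_conjTranspose_same
    (Matrix.of fun (a : n) (x : Fin 2 × n) => (![Yᴴ, 1] : Fin 2 → Matrix n n ℂ) x.1 a x.2)).trace_nonneg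
  have key : ∀ L : Fin 2 → Matrix n n ℂ, ∀ M : Fin 2 → Fin 2 → Matrix n n ℂ,
      (Matrix.of fun (a : n) (x : Fin 2 × n) => L x.1 a x.2) *
        (Matrix.of fun x y : Fin 2 × n => M x.1 y.1 x.2 y.2) *
        (Matrix.of fun (a : n) (x : Fin 2 × n) => L x.1 a x.2)ᴴ =
      L 0 * M 0 0 * (L 0)ᴴ + L 1 * M 1 0 * (L 0)ᴴ + (L 0 * M 0 1 * (L 1)ᴴ + L 1 * M 1 1 * (L 1)ᴴ) := by
    intro L M
    ext a b
    simp [Matrix.mul_apply, Fintype.sum_prod_type, Finset.sum_add_distrib, add_mul, Finset.sum_mul]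
    ring
  rw [key _ (fun i j => Φ ((![1, -Zᴴ] : Fin 2 → Matrix m m ℂ) i * σ *
    ((![1, -Zᴴ] : Fin 2 → Matrix m m ℂ) j)ᴴ))] at h2
  simp only [Matrix.cons_val_zero, Matrix.cons_val_one, Matrix.conjTranspose_one, one_mul, mul_one,
    Matrix.conjTranspose_neg, Matrix.conjTranspose_conjTranspose, neg_mul, mul_neg, neg_neg,
    map_neg, Matrix.trace_add, Matrix.trace_neg, hΦ.2, hYZ] at h2
  rw [Matrix.trace_mul_comm Yᴴ (Φ (σ * Z)), hYZ', Matrix.trace_mul_cycle σ Z Zᴴ] at h2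
  have h3 := (Complex.le_def.1 h2).1
  simp only [Complex.add_re, Complex.neg_re, Complex.zero_re] at h3
  linarith

lemma exists_adjoint [DecidableEq m] (Φ : Matrix m m ℂ →ₗ[ℂ] Matrix n n ℂ) (Y : Matrix n n ℂ) :
    ∃ Z : Matrix m m ℂ, ∀ X, (Φ X * Y).trace = (X * Z).trace := by
  refine ⟨Matrix.of fun i j => (Φ (Matrix.single j i 1) * Y).trace, fun X => ?_⟩
  conv_lhs => rw [Matrix.matrix_eq_sum_single X]
  simp only [map_sum, Finset.sum_mul, Matrix.trace_sum]
  simp only [Matrix.trace, Matrix.diag, Matrix.mul_apply (M := X)]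
  refine Finset.sum_congr rfl fun i _ => Finset.sum_congr rfl fun j _ => ?_
  have : Matrix.single i j (X i j) = X i j • Matrix.single i j 1 := by
    rw [Matrix.smul_single, smul_eq_mul, mul_one]
  rw [this, map_smul]
  simp [Finset.mul_sum, Matrix.mul_apply, mul_assoc]

end Channels

/-! ### Resolvent divergences and the trace norm: monotonicity and joint convexity -/

section Divergences

variable {m n : Type*} [Fintype m] [Fintype n] [DecidableEq m] [DecidableEq n]

/-- `ρ = U diag(p) Uᴴ` with `U` unitary. -/
structure Diagonalizes (U : Matrix n n ℂ) (p : n → ℝ) (ρ : Matrix n n ℂ) : Prop where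
  left : Uᴴ * U = 1
  right : U * Uᴴ = 1
  eq : ρ = U * Matrix.diagonal (fun i => (p i : ℂ)) * Uᴴ

lemma trace_conj_diagonal {U : Matrix n n ℂ} (hU : Uᴴ * U = 1) (p : n → ℝ) :
    (U * Matrix.diagonal (fun i => (p i : ℂ)) * Uᴴ).trace = ((∑ i, p i : ℝ) : ℂ) := by
  rw [Matrix.trace_mul_comm, ← mul_assoc, hU, one_mul, Matrix.trace_diagonal]
  push_cast
  rfl

lemma exists_diagonalizes {ρ : Matrix n n ℂ} (hρ : ρ.IsHermitian) :
    ∃ U p, Diagonalizes U p ρ ∧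
      ∀ f : ℝ → ℝ, cfc f ρ = U * Matrix.diagonal (fun i => (f (p i) : ℂ)) * Uᴴ := by
  refine ⟨hρ.eigenvectorUnitary, hρ.eigenvalues, ⟨?_, ?_, ?_⟩, fun f => ?_⟩
  · exact Unitary.coe_star_mul_self hρ.eigenvectorUnitary
  · exact Unitary.coe_mul_star_self hρ.eigenvectorUnitary
  · exact hρ.spectral_theorem
  · rw [hρ.cfc_eq]
    rfl

namespace Diagonalizes

variable {U V : Matrix n n ℂ} {p q : n → ℝ} {ρ σ : Matrix n n ℂ}

lemma conj_eq (h : Diagonalizes U p ρ) :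
    Uᴴ * ρ * U = Matrix.diagonal (fun i => (p i : ℂ)) := by
  rw [h.eq, ← mul_assoc, ← mul_assoc, h.left, one_mul, mul_assoc, h.left, mul_one]

lemma nonneg (h : Diagonalizes U p ρ) (hρ : ρ.PosSemidef) (i : n) : 0 ≤ p i := by
  have := (hρ.conjTranspose_mul_mul_same U).diag_nonneg (i := i)
  rw [h.conj_eq, Matrix.diagonal_apply_eq] at this
  exact_mod_cast this

lemma trace_eq (h : Diagonalizes U p ρ) : ρ.trace = ((∑ i, p i : ℝ) : ℂ) := by
  rw [h.eq, trace_conj_diagonal h.left]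

end Diagonalizes

/-- The quadratic form whose supremum over `Y` is `⟨ρ, (L_σ + t R_ρ)⁻¹ ρ⟩`. -/
def resolventForm (t : ℝ) (ρ σ Y : Matrix n n ℂ) : ℝ :=
  2 * (ρ * Y).trace.re - (Yᴴ * σ * Y).trace.re - t * (Y * ρ * Yᴴ).trace.re

/-- The resolvent divergence `⟨ρ, (L_σ + t R_ρ)⁻¹ ρ⟩` in variational form. -/
def resolventDiv (t : ℝ) (ρ σ : Matrix n n ℂ) : ℝ := ⨆ Y, resolventForm t ρ σ Y

/-- In the two eigenbases the form decouples into one scalar quadratic per matrix entry of `Y`, so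
it can be maximized entrywise. -/
lemma resolventForm_diagonal {U V : Matrix n n ℂ} {p q : n → ℝ} {ρ σ : Matrix n n ℂ}
    (hρ : Diagonalizes U p ρ) (hσ : Diagonalizes V q σ) (t : ℝ) (Y : Matrix n n ℂ) :
    resolventForm t ρ σ (V * Y * Uᴴ) =
      ∑ i, ∑ j, (2 * p i * ((Uᴴ * V) i j * Y j i).re
        - (q j + t * p i) * Complex.normSq (Y j i)) := by
  have h1 : (ρ * (V * Y * Uᴴ)).trace =
      (Matrix.diagonal (fun i => (p i : ℂ)) * ((Uᴴ * V) * Y)).trace := by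
    rw [hρ.eq, mul_assoc, mul_assoc, Matrix.trace_mul_comm]
    congr 1
    simp only [mul_assoc, hρ.left, mul_one]
  have h2 : ((V * Y * Uᴴ)ᴴ * σ * (V * Y * Uᴴ)).trace =
      (Yᴴ * Matrix.diagonal (fun i => (q i : ℂ)) * Y).trace := by
    rw [← hσ.conj_eq, Matrix.conjTranspose_mul, Matrix.conjTranspose_mul,
      Matrix.conjTranspose_conjTranspose, mul_assoc, mul_assoc, Matrix.trace_mul_comm]
    congr 1
    simp only [mul_assoc, hρ.left, mul_one]
  have h3 : ((V * Y * Uᴴ) * ρ * (V * Y * Uᴴ)ᴴ).trace =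
      (Y * Matrix.diagonal (fun i => (p i : ℂ)) * Yᴴ).trace := by
    rw [← hρ.conj_eq, Matrix.conjTranspose_mul, Matrix.conjTranspose_mul,
      Matrix.conjTranspose_conjTranspose, mul_assoc, mul_assoc, mul_assoc, Matrix.trace_mul_comm]
    congr 1
    simp only [mul_assoc, hσ.left, mul_one]
  have e1 : (Matrix.diagonal (fun i => (p i : ℂ)) * ((Uᴴ * V) * Y)).trace.re =
      ∑ i, ∑ j, p i * ((Uᴴ * V) i j * Y j i).re := by
    simp only [Matrix.trace, Matrix.diag, Matrix.diagonal_mul, Matrix.mul_apply (N := Y),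
      Complex.re_sum, Complex.re_ofReal_mul, Finset.mul_sum]
  have e2 : (Yᴴ * Matrix.diagonal (fun i => (q i : ℂ)) * Y).trace.re =
      ∑ i, ∑ j, q j * Complex.normSq (Y j i) := by
    simp only [Matrix.trace, Matrix.diag, Matrix.mul_apply (N := Y), Matrix.mul_diagonal,
      Complex.re_sum, Matrix.conjTranspose_apply]
    refine Finset.sum_congr rfl fun i _ => Finset.sum_congr rfl fun j _ => ?_
    simp [Complex.normSq_apply]; ring
  have e3 : (Y * Matrix.diagonal (fun i => (p i : ℂ)) * Yᴴ).trace.re =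
      ∑ i, ∑ j, p i * Complex.normSq (Y j i) := by
    rw [Finset.sum_comm]
    simp only [Matrix.trace, Matrix.diag, Matrix.mul_apply (N := Yᴴ), Matrix.mul_diagonal,
      Complex.re_sum, Matrix.conjTranspose_apply]
    refine Finset.sum_congr rfl fun i _ => Finset.sum_congr rfl fun j _ => ?_
    simp [Complex.normSq_apply]; ring
  rw [resolventForm, h1, h2, h3, e1, e2, e3]
  simp only [Finset.mul_sum, ← Finset.sum_sub_distrib]
  refine Finset.sum_congr rfl fun i _ => Finset.sum_congr rfl fun j _ => ?_
  ring

lemma isGreatest_resolventForm {U V : Matrix n n ℂ} {p q : n → ℝ} {ρ σ : Matrix n n ℂ}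
    (hρ : Diagonalizes U p ρ) (hσ : Diagonalizes V q σ) (hp : ∀ i, 0 ≤ p i) (hq : ∀ i, 0 ≤ q i)
    {t : ℝ} (ht : 0 < t) :
    IsGreatest (Set.range (resolventForm t ρ σ))
      (∑ i, ∑ j, Complex.normSq ((Uᴴ * V) i j) * (p i ^ 2 / (q j + t * p i))) := by
  constructor
  -- The critical point of each scalar quadratic, which solves `σ Y + t Y ρ = ρ` entrywise.
  · refine ⟨V * (Matrix.of fun j i => ((p i / (q j + t * p i) : ℝ) : ℂ) *
      star ((Uᴴ * V) i j)) * Uᴴ, ?_⟩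
    rw [resolventForm_diagonal hρ hσ]
    refine Finset.sum_congr rfl fun i _ => Finset.sum_congr rfl fun j _ => ?_
    set w := (Uᴴ * V) i j
    have e1 : (w * (((p i / (q j + t * p i) : ℝ) : ℂ) * star w)).re =
        p i / (q j + t * p i) * Complex.normSq w := by
      rw [mul_left_comm, Complex.re_ofReal_mul, Complex.star_def, Complex.mul_conj,
        Complex.ofReal_re]
    simp only [Matrix.of_apply]
    rw [e1, Complex.normSq_mul, Complex.normSq_ofReal, Complex.star_def, Complex.normSq_conj]
    rcases (add_nonneg (hq j) (mul_nonneg ht.le (hp i))).eq_or_lt with h | h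
    · simp [← h]
    · field_simp
      ring
  · rintro _ ⟨Y, rfl⟩
    have hY : Y = V * (Vᴴ * Y * U) * Uᴴ := by
      simp only [mul_assoc, hρ.right, mul_one]
      rw [← mul_assoc, hσ.right, one_mul]
    rw [hY, resolventForm_diagonal hρ hσ]
    refine Finset.sum_le_sum fun i _ => Finset.sum_le_sum fun j _ => ?_
    set w := (Uᴴ * V) i j
    set y := (Vᴴ * Y * U) j i
    -- A vanishing denominator forces `p i = 0` because `t > 0`, so the convention `x / 0 = 0` gives
    -- the right value and no invertibility is needed.
    rcases (add_nonneg (hq j) (mul_nonneg ht.le (hp i))).eq_or_lt with h | h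
    · have hp0 : p i = 0 := by
        have := hp i
        have := hq j
        nlinarith
      simpa [hp0] using mul_nonneg (hq j) (Complex.normSq_nonneg y)
    · rw [mul_div_assoc', le_div_iff₀ h]
      have e : (w * y).re = w.re * y.re - w.im * y.im := Complex.mul_re _ _
      rw [e, Complex.normSq_apply, Complex.normSq_apply]
      nlinarith [sq_nonneg (p i * w.re - (q j + t * p i) * y.re),
        sq_nonneg (p i * w.im + (q j + t * p i) * y.im)]

lemma resolventDiv_eq {U V : Matrix n n ℂ} {p q : n → ℝ} {ρ σ : Matrix n n ℂ}
    (hρ : Diagonalizes U p ρ) (hσ : Diagonalizes V q σ) (hp : ∀ i, 0 ≤ p i) (hq : ∀ i, 0 ≤ q i)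
    {t : ℝ} (ht : 0 < t) :
    resolventDiv t ρ σ =
      ∑ i, ∑ j, Complex.normSq ((Uᴴ * V) i j) * (p i ^ 2 / (q j + t * p i)) :=
  (isGreatest_resolventForm hρ hσ hp hq ht).csSup_eq

lemma isGreatest_resolventDiv {ρ σ : Matrix n n ℂ} (hρ : ρ.PosSemidef) (hσ : σ.PosSemidef)
    {t : ℝ} (ht : 0 < t) :
    IsGreatest (Set.range (resolventForm t ρ σ)) (resolventDiv t ρ σ) := by
  obtain ⟨U, p, hU, -⟩ := exists_diagonalizes hρ.isHermitian
  obtain ⟨V, q, hV, -⟩ := exists_diagonalizes hσ.isHermitian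
  have h := isGreatest_resolventForm hU hV (hU.nonneg hρ) (hV.nonneg hσ) ht
  rwa [resolventDiv, iSup, h.csSup_eq]

/-- The adjoint image `Z` of an optimal `Y` for the output is a test operator for the input: the
linear term is unchanged, and Kadison–Schwarz, used for `Y` with `σ` and for `Yᴴ` with `ρ`, shows
that both subtracted terms do not grow. -/
lemma resolventDiv_channel_le {Φ : Matrix m m ℂ →ₗ[ℂ] Matrix n n ℂ} (hΦ : IsChannel Φ)
    {ρ σ : Matrix m m ℂ} (hρ : ρ.PosSemidef) (hσ : σ.PosSemidef) {t : ℝ} (ht : 0 < t) :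
    resolventDiv t (Φ ρ) (Φ σ) ≤ resolventDiv t ρ σ := by
  obtain ⟨Y, hY⟩ := (isGreatest_resolventDiv (hΦ.1.posSemidef hρ) (hΦ.1.posSemidef hσ) ht).1
  obtain ⟨Z, hZ⟩ := exists_adjoint Φ Y
  rw [← hY]
  refine le_trans ?_ ((isGreatest_resolventDiv hρ hσ ht).2 ⟨Z, rfl⟩)
  have h1 := hΦ.schwarz hZ hσ
  have h2 := hΦ.schwarz (hΦ.adjoint_conjTranspose hZ) hρ
  simp only [Matrix.conjTranspose_conjTranspose] at h2
  have h3 := mul_le_mul_of_nonneg_left h2 ht.le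
  rw [resolventForm, resolventForm, hZ]
  linarith

lemma resolventForm_convexComb (t a b : ℝ) (ρ₁ ρ₂ σ₁ σ₂ Y : Matrix n n ℂ) :
    resolventForm t (a • ρ₁ + b • ρ₂) (a • σ₁ + b • σ₂) Y =
      a * resolventForm t ρ₁ σ₁ Y + b * resolventForm t ρ₂ σ₂ Y := by
  simp only [resolventForm, add_mul, mul_add, Matrix.smul_mul, Matrix.mul_smul, Matrix.trace_add,
    Matrix.trace_smul, Complex.add_re, Complex.smul_re, smul_eq_mul]
  ring

lemma resolventDiv_convexComb_le {ρ₁ ρ₂ σ₁ σ₂ : Matrix n n ℂ} (hρ₁ : ρ₁.PosSemidef)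
    (hρ₂ : ρ₂.PosSemidef) (hσ₁ : σ₁.PosSemidef) (hσ₂ : σ₂.PosSemidef) {a b : ℝ} (ha : 0 ≤ a)
    (hb : 0 ≤ b) {t : ℝ} (ht : 0 < t) :
    resolventDiv t (a • ρ₁ + b • ρ₂) (a • σ₁ + b • σ₂) ≤
      a * resolventDiv t ρ₁ σ₁ + b * resolventDiv t ρ₂ σ₂ := by
  obtain ⟨Y, hY⟩ := (isGreatest_resolventDiv ((hρ₁.smul ha).add (hρ₂.smul hb))
    ((hσ₁.smul ha).add (hσ₂.smul hb)) ht).1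
  rw [← hY, resolventForm_convexComb]
  exact add_le_add
    (mul_le_mul_of_nonneg_left ((isGreatest_resolventDiv hρ₁ hσ₁ ht).2 ⟨Y, rfl⟩) ha)
    (mul_le_mul_of_nonneg_left ((isGreatest_resolventDiv hρ₂ hσ₂ ht).2 ⟨Y, rfl⟩) hb)

lemma exists_traceNorm_eq {X : Matrix n n ℂ} (hX : X.IsHermitian) :
    ∃ U p, Diagonalizes U p X ∧ traceNorm X = ∑ i, |p i| := by
  obtain ⟨U, p, hU, hf⟩ := exists_diagonalizes hX
  refine ⟨U, p, hU, ?_⟩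
  have hs : cfc (fun x : ℝ => x ^ 2) X = Xᴴ * X := by
    rw [cfc_pow_id X 2 hX.isSelfAdjoint, hX.eq, sq]
  rw [traceNorm, ← hs, ← cfc_comp' Real.sqrt (fun x => x ^ 2) X Real.continuous_sqrt.continuousOn
    (by fun_prop) hX.isSelfAdjoint, hf, trace_conj_diagonal hU.left, Complex.ofReal_re]
  simp only [Real.sqrt_sq_eq_abs]

lemma traceNorm_nonneg {X : Matrix n n ℂ} (hX : X.IsHermitian) : 0 ≤ traceNorm X := by
  obtain ⟨U, p, -, h⟩ := exists_traceNorm_eq hX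
  rw [h]
  exact Finset.sum_nonneg fun i _ => abs_nonneg _

lemma traceNorm_sub_le {P Q : Matrix n n ℂ} (hP : P.PosSemidef) (hQ : Q.PosSemidef) :
    traceNorm (P - Q) ≤ P.trace.re + Q.trace.re := by
  obtain ⟨U, p, hU, h⟩ := exists_traceNorm_eq (hP.isHermitian.sub hQ.isHermitian)
  have htr : ∀ R : Matrix n n ℂ, R.trace.re = ∑ i, ((Uᴴ * R * U) i i).re := fun R => by
    rw [← Complex.re_sum]
    change _ = (Uᴴ * R * U).trace.re
    rw [Matrix.trace_mul_comm, ← mul_assoc, hU.right, one_mul]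
  rw [h, htr P, htr Q, ← Finset.sum_add_distrib]
  refine Finset.sum_le_sum fun i _ => ?_
  have h0 := congrArg Complex.re (congrFun (congrFun hU.conj_eq i) i)
  rw [mul_sub, sub_mul, Matrix.sub_apply, Matrix.diagonal_apply_eq, Complex.sub_re,
    Complex.ofReal_re] at h0
  have h1 := (Complex.le_def.1 ((hP.conjTranspose_mul_mul_same U).diag_nonneg (i := i))).1
  have h2 := (Complex.le_def.1 ((hQ.conjTranspose_mul_mul_same U).diag_nonneg (i := i))).1
  simp only [Complex.zero_re] at h1 h2
  rw [← h0, abs_le]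
  constructor <;> linarith

/-- Jordan decomposition. Together with `traceNorm_sub_le` it makes the trace norm the least value
of `Tr P + Tr Q` over decompositions `X = P - Q`, from which monotonicity and convexity follow at
once. -/
lemma exists_posSemidef_sub {X : Matrix n n ℂ} (hX : X.IsHermitian) :
    ∃ P Q : Matrix n n ℂ, P.PosSemidef ∧ Q.PosSemidef ∧ X = P - Q ∧
      traceNorm X = P.trace.re + Q.trace.re := by
  obtain ⟨U, p, hU, h⟩ := exists_traceNorm_eq hX
  have hd : ∀ f : n → ℝ, (∀ i, 0 ≤ f i) →
      (U * Matrix.diagonal (fun i => (f i : ℂ)) * Uᴴ).PosSemidef := fun f hf =>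
    (Matrix.PosSemidef.diagonal fun i => by
      simpa using hf i).mul_mul_conjTranspose_same U
  refine ⟨_, _, hd (fun i => (p i)⁺) fun i => posPart_nonneg _,
    hd (fun i => (p i)⁻) fun i => negPart_nonneg _, ?_, ?_⟩
  · rw [hU.eq, ← sub_mul, ← mul_sub, Matrix.diagonal_sub]
    congr! 4 with i
    rw [← Complex.ofReal_sub, posPart_sub_negPart]
  · rw [h, trace_conj_diagonal hU.left, trace_conj_diagonal hU.left, Complex.ofReal_re,
      Complex.ofReal_re, ← Finset.sum_add_distrib]
    simp only [posPart_add_negPart]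

lemma traceNorm_channel_le {Φ : Matrix m m ℂ →ₗ[ℂ] Matrix n n ℂ} (hΦ : IsChannel Φ)
    {X : Matrix m m ℂ} (hX : X.IsHermitian) : traceNorm (Φ X) ≤ traceNorm X := by
  obtain ⟨P, Q, hP, hQ, rfl, h⟩ := exists_posSemidef_sub hX
  rw [h, map_sub, ← hΦ.2 P, ← hΦ.2 Q]
  exact traceNorm_sub_le (hΦ.1.posSemidef hP) (hΦ.1.posSemidef hQ)

lemma traceNorm_convexComb_le {X Y : Matrix n n ℂ} (hX : X.IsHermitian) (hY : Y.IsHermitian)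
    {a b : ℝ} (ha : 0 ≤ a) (hb : 0 ≤ b) :
    traceNorm (a • X + b • Y) ≤ a * traceNorm X + b * traceNorm Y := by
  obtain ⟨P, Q, hP, hQ, rfl, h⟩ := exists_posSemidef_sub hX
  obtain ⟨P', Q', hP', hQ', rfl, h'⟩ := exists_posSemidef_sub hY
  have e : a • (P - Q) + b • (P' - Q') = (a • P + b • P') - (a • Q + b • Q') := by
    simp only [smul_sub]; abel
  rw [h, h', e]
  refine (traceNorm_sub_le ((hP.smul ha).add (hP'.smul hb))
    ((hQ.smul ha).add (hQ'.smul hb))).trans_eq ?_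
  simp only [Matrix.trace_add, Matrix.trace_smul, Complex.add_re, Complex.smul_re, smul_eq_mul]
  ring

/-- The trace distance (`none`) and the resolvent divergences (`some t`, `t > 0`), treated as one
family of jointly convex divergences that are monotone under channels. -/
def divergence : Option ℝ → Matrix n n ℂ → Matrix n n ℂ → ℝ
  | none, ρ, σ => traceNorm (ρ - σ)
  | some t, ρ, σ => resolventDiv t ρ σ

lemma divergence_channel_le {x : Option ℝ} (hx : ∀ t ∈ x, 0 < t)
    {Φ : Matrix m m ℂ →ₗ[ℂ] Matrix n n ℂ} (hΦ : IsChannel Φ)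
    {ρ σ : Matrix m m ℂ} (hρ : ρ.PosSemidef) (hσ : σ.PosSemidef) :
    divergence x (Φ ρ) (Φ σ) ≤ divergence x ρ σ := by
  cases x with
  | none =>
    change traceNorm (Φ ρ - Φ σ) ≤ _
    rw [← map_sub]
    exact traceNorm_channel_le hΦ (hρ.isHermitian.sub hσ.isHermitian)
  | some t => exact resolventDiv_channel_le hΦ hρ hσ (hx t rfl)

lemma divergence_convexComb_le {x : Option ℝ} (hx : ∀ t ∈ x, 0 < t)
    {ρ₁ ρ₂ σ₁ σ₂ : Matrix n n ℂ} (hρ₁ : ρ₁.PosSemidef)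
    (hρ₂ : ρ₂.PosSemidef) (hσ₁ : σ₁.PosSemidef) (hσ₂ : σ₂.PosSemidef) {a b : ℝ} (ha : 0 ≤ a)
    (hb : 0 ≤ b) :
    divergence x (a • ρ₁ + b • ρ₂) (a • σ₁ + b • σ₂) ≤
      a * divergence x ρ₁ σ₁ + b * divergence x ρ₂ σ₂ := by
  cases x with
  | none =>
    have e : (a • ρ₁ + b • ρ₂) - (a • σ₁ + b • σ₂) = a • (ρ₁ - σ₁) + b • (ρ₂ - σ₂) := by
      simp only [smul_sub]; abel
    change traceNorm _ ≤ _
    rw [e]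
    exact traceNorm_convexComb_le (hρ₁.isHermitian.sub hσ₁.isHermitian)
      (hρ₂.isHermitian.sub hσ₂.isHermitian) ha hb
  | some t => exact resolventDiv_convexComb_le hρ₁ hρ₂ hσ₁ hσ₂ ha hb (hx t rfl)

end Divergences

/-! ### Contraction of the conditional divergence -/

section Contraction

variable {a b c b' c' h κ m n : Type*} [Fintype a] [Fintype b] [Fintype c] [Fintype b']
  [Fintype c'] [Fintype h] [Fintype κ] [Fintype m] [Fintype n]
  [DecidableEq a] [DecidableEq b] [DecidableEq c] [DecidableEq b'] [DecidableEq c']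
  [DecidableEq h] [DecidableEq κ] [DecidableEq m] [DecidableEq n]

/-- Divergence of a bipartite operator from the product of its marginals. -/
def mutualDiv (x : Option ℝ) (ρ : Matrix (a × n) (a × n) ℂ) : ℝ :=
  divergence x ρ (traceRight ρ ⊗ₖ traceLeft ρ)

/-- The conditional version of `mutualDiv`. -/
def condDiv (x : Option ℝ) (ρ : Matrix (a × b × c) (a × b × c) ℂ) : ℝ :=
  mutualDiv x ρ - mutualDiv x (margAB ρ)

lemma margAB_eq_idTensor (ρ : Matrix (a × b × c) (a × b × c) ℂ) :
    margAB ρ = idTensor (traceRightLM b c) ρ := rfl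

lemma traceLeft_margAB (ρ : Matrix (a × b × c) (a × b × c) ℂ) :
    traceLeft (margAB ρ) = margB ρ := by
  rw [margAB_eq_idTensor, traceLeft_idTensor]; rfl

lemma traceRight_margAB (ρ : Matrix (a × b × c) (a × b × c) ℂ) :
    traceRight (margAB ρ) = margA ρ := traceRight_idTensor isChannel_traceRightLM ρ

lemma IsState.margAB {ρ : Matrix (a × b × c) (a × b × c) ℂ} (hρ : IsState ρ) :
    IsState (margAB ρ) := isChannel_traceRightLM.idTensorLM.isState hρ

lemma cmiTraceNorm_eq_condDiv (ρ : Matrix (a × b × c) (a × b × c) ℂ) :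
    cmiTraceNorm ρ = condDiv none ρ := by
  rw [cmiTraceNorm, condDiv, mutualDiv, mutualDiv, traceLeft_margAB, traceRight_margAB]
  rfl

/-- A local channel carries the product of the marginals to the product of the new marginals, so
both arguments of the divergence are images under one map. -/
lemma mutualDiv_idTensor {Φ : Matrix m m ℂ →ₗ[ℂ] Matrix n n ℂ} (hΦ : IsChannel Φ)
    (x : Option ℝ) (ρ : Matrix (a × m) (a × m) ℂ) :
    mutualDiv x (idTensor Φ ρ) =
      divergence x (idTensor Φ ρ) (idTensor Φ (traceRight ρ ⊗ₖ traceLeft ρ)) := by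
  rw [mutualDiv, traceRight_idTensor hΦ, traceLeft_idTensor, idTensor_kronecker]

lemma mutualDiv_idTensor_le {x : Option ℝ} (hx : ∀ t ∈ x, 0 < t)
    {Φ : Matrix m m ℂ →ₗ[ℂ] Matrix n n ℂ} (hΦ : IsChannel Φ)
    {ρ : Matrix (a × m) (a × m) ℂ} (hρ : IsState ρ) :
    mutualDiv x (idTensor Φ ρ) ≤ mutualDiv x ρ := by
  rw [mutualDiv_idTensor hΦ]
  exact divergence_channel_le hx hΦ.idTensorLM hρ.1 (hρ.traceRight.kronecker hρ.traceLeft).1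

/-- Mutual information is not convex in the state, but here `ρ_A` is common to all outputs, so the
state and the product of marginals split with the same weights and joint convexity applies. -/
lemma mutualDiv_convexComb_le {x : Option ℝ} (hx : ∀ t ∈ x, 0 < t)
    {Φ Φ₁ Φ₂ : Matrix m m ℂ →ₗ[ℂ] Matrix n n ℂ} (hΦ : IsChannel Φ) (hΦ₁ : IsChannel Φ₁)
    (hΦ₂ : IsChannel Φ₂) {s t : ℝ} (hs : 0 ≤ s) (ht : 0 ≤ t) (h : Φ = s • Φ₁ + t • Φ₂)
    {ρ : Matrix (a × m) (a × m) ℂ} (hρ : IsState ρ) :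
    mutualDiv x (idTensor Φ ρ) ≤
      s * mutualDiv x (idTensor Φ₁ ρ) + t * mutualDiv x (idTensor Φ₂ ρ) := by
  have hσ := (hρ.traceRight.kronecker hρ.traceLeft).1
  rw [mutualDiv_idTensor hΦ, mutualDiv_idTensor hΦ₁, mutualDiv_idTensor hΦ₂, h,
    idTensor_add_smul, idTensor_add_smul]
  exact divergence_convexComb_le hx (hΦ₁.1.idTensor_posSemidef hρ.1)
    (hΦ₂.1.idTensor_posSemidef hρ.1) (hΦ₁.1.idTensor_posSemidef hσ)
    (hΦ₂.1.idTensor_posSemidef hσ) hs ht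

lemma condDiv_nonneg {x : Option ℝ} (hx : ∀ t ∈ x, 0 < t)
    {ρ : Matrix (a × b × c) (a × b × c) ℂ} (hρ : IsState ρ) : 0 ≤ condDiv x ρ :=
  sub_nonneg.2 (mutualDiv_idTensor_le hx isChannel_traceRightLM hρ)

/-- The recovery map `T` produces the old state on `AB` from the new one on `AB'`, so this is
monotonicity under `T`. -/
lemma mutualDiv_margAB_le_of_recovery {x : Option ℝ} (hx : ∀ t ∈ x, 0 < t)
    {Φ : Matrix (b × c) (b × c) ℂ →ₗ[ℂ] Matrix (b' × c') (b' × c') ℂ} (hΦ : IsChannel Φ)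
    {T : Matrix b' b' ℂ →ₗ[ℂ] Matrix b b ℂ} (hT : IsChannel T)
    (hTΦ : ∀ X, T (traceRight (Φ X)) = traceRight X)
    {ρ : Matrix (a × b × c) (a × b × c) ℂ} (hρ : IsState ρ) :
    mutualDiv x (margAB ρ) ≤ mutualDiv x (margAB (idTensor Φ ρ)) := by
  have h : margAB ρ = idTensor T (margAB (idTensor Φ ρ)) := by
    rw [margAB_eq_idTensor, margAB_eq_idTensor, ← idTensor_comp, ← idTensor_comp]
    congr 1
    exact LinearMap.ext fun X => (hTΦ X).symm
  rw [h]
  exact mutualDiv_idTensor_le hx hT (IsState.margAB (hΦ.idTensorLM.isState hρ))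

/-- A channel on `BC` from whose output on `B'` the reduced operator on `B` can be recovered does
not increase the conditional divergence. -/
lemma condDiv_idTensor_le {x : Option ℝ} (hx : ∀ t ∈ x, 0 < t)
    {Φ : Matrix (b × c) (b × c) ℂ →ₗ[ℂ] Matrix (b' × c') (b' × c') ℂ} (hΦ : IsChannel Φ)
    {T : Matrix b' b' ℂ →ₗ[ℂ] Matrix b b ℂ} (hT : IsChannel T)
    (hTΦ : ∀ X, T (traceRight (Φ X)) = traceRight X)
    {ρ : Matrix (a × b × c) (a × b × c) ℂ} (hρ : IsState ρ) :
    condDiv x (idTensor Φ ρ) ≤ condDiv x ρ :=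
  sub_le_sub (mutualDiv_idTensor_le hx hΦ hρ)
    (mutualDiv_margAB_le_of_recovery hx hΦ hT hTΦ hρ)

/-- If, with weight `1 - η`, the channel on `BC` depends on its input through the `B` part only,
then the conditional divergence shrinks by the factor `η`. -/
lemma condDiv_idTensor_le_mul {x : Option ℝ} (hx : ∀ t ∈ x, 0 < t)
    {Φ Φ' : Matrix (b × c) (b × c) ℂ →ₗ[ℂ] Matrix (b' × c') (b' × c') ℂ} (hΦ : IsChannel Φ)
    (hΦ' : IsChannel Φ') {Γ : Matrix b b ℂ →ₗ[ℂ] Matrix (b' × c') (b' × c') ℂ} (hΓ : IsChannel Γ)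
    {η : ℝ} (hη0 : 0 ≤ η) (hη1 : η ≤ 1)
    (hdec : Φ = (1 - η) • (Γ ∘ₗ traceRightLM b c) + η • Φ')
    {T : Matrix b' b' ℂ →ₗ[ℂ] Matrix b b ℂ} (hT : IsChannel T)
    (hTΦ : ∀ X, T (traceRight (Φ X)) = traceRight X)
    {ρ : Matrix (a × b × c) (a × b × c) ℂ} (hρ : IsState ρ) :
    condDiv x (idTensor Φ ρ) ≤ η * condDiv x ρ := by
  have h1 := mutualDiv_convexComb_le hx hΦ (hΓ.comp isChannel_traceRightLM) hΦ'
    (sub_nonneg.2 hη1) hη0 hdec hρ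
  have h2 := mutualDiv_idTensor_le hx hΦ' hρ
  have h3 : mutualDiv x (idTensor (Γ ∘ₗ traceRightLM b c) ρ) ≤ mutualDiv x (margAB ρ) :=
    mutualDiv_idTensor_le hx hΓ hρ.margAB
  -- The subtracted term of the output is at least the old one, which absorbs the weight `1 - η` and
  -- leaves `η` times the old difference.
  have h4 := mutualDiv_margAB_le_of_recovery hx hΦ hT hTΦ hρ
  have h5 := mul_le_mul_of_nonneg_left h2 hη0
  have h6 := mul_le_mul_of_nonneg_left h3 (sub_nonneg.2 hη1)
  rw [condDiv, condDiv]
  linarith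

-- Positive operators span all operators, and each is its trace times a state unless its trace
-- vanishes, in which case it is zero. The extension to all operators is needed because `id ⊗ F`
-- evaluates `F` on arbitrary blocks.
open scoped Matrix.Norms.L2Operator MatrixOrder in
lemma IsForgetful.exists_apply_eq {F : Matrix m m ℂ →ₗ[ℂ] Matrix n n ℂ} (hF : IsForgetful F) :
    ∃ σ, IsState σ ∧ ∀ X, F X = X.trace • σ := by
  obtain ⟨hc, σ, hσ, h⟩ := hF
  refine ⟨σ, hσ, fun X => ?_⟩
  have hX : X ∈ Submodule.span ℂ {A : Matrix m m ℂ | 0 ≤ A} := by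
    rw [CStarAlgebra.span_nonneg]; trivial
  induction hX using Submodule.span_induction with
  | mem A hA =>
    have hA : A.PosSemidef := Matrix.nonneg_iff_posSemidef.1 hA
    by_cases h0 : A.trace = 0
    · rw [h0, zero_smul, hA.trace_eq_zero_iff.1 h0, map_zero]
    · have hs : IsState (A.trace⁻¹ • A) :=
        ⟨hA.smul (inv_nonneg.2 hA.trace_nonneg), by
          rw [Matrix.trace_smul, smul_eq_mul, inv_mul_cancel₀ h0]⟩
      rw [← h _ hs, map_smul, smul_smul, mul_inv_cancel₀ h0, one_smul]
  | zero => simp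
  | add X Y _ _ hX hY => rw [map_add, hX, hY, Matrix.trace_add, add_smul]
  | smul c X _ hX => rw [map_smul, hX, Matrix.trace_smul, smul_smul, smul_eq_mul]

/-- The map `X ↦ (id_B ⊗ N) X` from `BC` to `(B B₁) C`. -/
def stepLM (b : Type*) (N : Matrix h h ℂ →ₗ[ℂ] Matrix (κ × h) (κ × h) ℂ) :
    Matrix (b × h) (b × h) ℂ →ₗ[ℂ] Matrix ((b × κ) × h) ((b × κ) × h) ℂ :=
  reindexLM (Equiv.prodAssoc b κ h).symm ∘ₗ idTensorLM b N

lemma isChannel_stepLM {N : Matrix h h ℂ →ₗ[ℂ] Matrix (κ × h) (κ × h) ℂ} (hN : IsChannel N) :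
    IsChannel (stepLM b N) := (isChannel_reindexLM _).comp hN.idTensorLM

lemma traceRight_traceRight_stepLM {N : Matrix h h ℂ →ₗ[ℂ] Matrix (κ × h) (κ × h) ℂ}
    (hN : IsChannel N) (X : Matrix (b × h) (b × h) ℂ) :
    traceRight (traceRight (stepLM b N X)) = traceRight X := by
  rw [← traceRight_idTensor hN X]
  ext i j
  simp [traceRight, Fintype.sum_prod_type, stepLM, reindexLM_apply]

lemma isState_applyOnC {N : Matrix h h ℂ →ₗ[ℂ] Matrix (κ × h) (κ × h) ℂ} (hN : IsChannel N)
    {ρ : Matrix (a × b × h) (a × b × h) ℂ} (hρ : IsState ρ) : IsState (applyOnC N ρ) :=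
  (isChannel_stepLM hN).idTensorLM.isState hρ

lemma condDiv_applyOnC_le {x : Option ℝ} (hx : ∀ t ∈ x, 0 < t)
    {N F N' : Matrix h h ℂ →ₗ[ℂ] Matrix (κ × h) (κ × h) ℂ} {η : ℝ}
    (hη0 : 0 ≤ η) (hη1 : η ≤ 1) (hN : IsChannel N) (hF : IsForgetful F) (hN' : IsChannel N')
    (hdec : N = (1 - η) • F + η • N') {ρ : Matrix (a × b × h) (a × b × h) ℂ} (hρ : IsState ρ) :
    condDiv x (applyOnC N ρ) ≤ η * condDiv x ρ := by
  obtain ⟨σ, hσ, hFσ⟩ := hF.exists_apply_eq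
  refine condDiv_idTensor_le_mul hx (isChannel_stepLM hN) (isChannel_stepLM hN')
    ((isChannel_reindexLM (Equiv.prodAssoc b κ h).symm).comp (isChannel_kroneckerLM hσ)) hη0 hη1
    ?_ isChannel_traceRightLM (traceRight_traceRight_stepLM hN) hρ
  -- The forgetful branch discards `C` and adjoins `σ`, so it factors through the partial trace onto
  -- `B`.
  have hFstep : stepLM b F = (reindexLM (Equiv.prodAssoc b κ h).symm ∘ₗ kroneckerLM σ) ∘ₗ
      traceRightLM b h := by
    refine LinearMap.ext fun X => ?_
    ext i j
    change F (Matrix.of fun p q => X (i.1.1, p) (j.1.1, q)) (i.1.2, i.2) (j.1.2, j.2) = _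
    rw [hFσ]
    rfl
  rw [← hFstep, hdec]
  rfl

end Contraction

/-! ### Relative entropy as a limit of integrals of resolvent divergences -/

section RelativeEntropy

open MeasureTheory Filter Topology

/-- The antiderivative is `w * p * log (q + t * p)`. The support condition makes the integrand
vanish identically when `q = 0`, where it would otherwise behave like `1 / t`. -/
lemma integral_resolvent {w p q : ℝ} (hp : 0 ≤ p) (hq : 0 ≤ q) (h : q = 0 → w * p = 0)
    {T : ℝ} (hT : 0 ≤ T) :
    IntervalIntegrable (fun t => w * (p ^ 2 / (q + t * p))) volume 0 T ∧
      ∫ t in (0 : ℝ)..T, w * (p ^ 2 / (q + t * p)) =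
        w * p * (Real.log (q + T * p) - Real.log q) := by
  by_cases hwp : w * p = 0
  · have hz : (fun t => w * (p ^ 2 / (q + t * p))) = fun _ => 0 := by
      funext t
      rw [show w * (p ^ 2 / (q + t * p)) = w * p * (p / (q + t * p)) by ring, hwp, zero_mul]
    rw [hz, hwp]
    simp
  · have hq' : 0 < q := hq.lt_of_ne fun h0 => hwp (h h0.symm)
    have hpos : ∀ t ∈ Set.uIcc 0 T, 0 < q + t * p := fun t ht => by
      rw [Set.uIcc_of_le hT] at ht
      exact add_pos_of_pos_of_nonneg hq' (mul_nonneg ht.1 hp)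
    have hint : IntervalIntegrable (fun t => w * (p ^ 2 / (q + t * p))) volume 0 T := by
      refine ContinuousOn.intervalIntegrable ?_
      refine continuousOn_const.mul (continuousOn_const.div (by fun_prop) fun t ht => ?_)
      exact (hpos t ht).ne'
    refine ⟨hint, ?_⟩
    rw [intervalIntegral.integral_eq_sub_of_hasDerivAt
      (f := fun t => w * p * Real.log (q + t * p)) (fun t ht => ?_) hint]
    · simp; ring
    · have h1 : HasDerivAt (fun t : ℝ => q + t * p) p t := by
        simpa using ((hasDerivAt_id t).mul_const p).const_add q
      refine ((h1.log (hpos t ht).ne').const_mul (w * p)).congr_deriv ?_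
      ring

/-- For `p > 0` the quotient `(q + T p) / (1 + T)` tends to `p`, so subtracting `log (1 + T)`
removes exactly the divergent part. -/
lemma tendsto_log_affine {w p q : ℝ} (hp : 0 ≤ p) (hq : 0 ≤ q) :
    Tendsto (fun T => w * p * (Real.log (q + T * p) - Real.log q) - Real.log (1 + T) * (w * p))
      atTop (𝓝 (w * p * (Real.log p - Real.log q))) := by
  rcases hp.eq_or_lt with rfl | hp
  · simp
  have h1 : Tendsto (fun T : ℝ => p + (q - p) / (1 + T)) atTop (𝓝 p) := by
    simpa using tendsto_const_nhds.add
      (tendsto_const_nhds.div_atTop (tendsto_atTop_add_const_left atTop (1 : ℝ) tendsto_id))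
  have h2 := (((Real.continuousAt_log hp.ne').tendsto.comp h1).sub_const (Real.log q)).const_mul
    (w * p)
  refine h2.congr' ?_
  filter_upwards [eventually_gt_atTop 0] with T hT
  have e : p + (q - p) / (1 + T) = (q + T * p) / (1 + T) := by
    field_simp; ring
  rw [Function.comp_apply, e, Real.log_div (by positivity) (by positivity)]
  ring

variable {n : Type*} [Fintype n] [DecidableEq n]

lemma sum_normSq_overlap {U V : Matrix n n ℂ} (hU : Uᴴ * U = 1) (hV : V * Vᴴ = 1) (i : n) :
    ∑ j, Complex.normSq ((Uᴴ * V) i j) = 1 := by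
  have h : ((Uᴴ * V) * (Uᴴ * V)ᴴ) i i = 1 := by
    rw [Matrix.conjTranspose_mul, Matrix.conjTranspose_conjTranspose, mul_assoc, ← mul_assoc V,
      hV, one_mul, hU, Matrix.one_apply_eq]
  rw [Matrix.mul_apply] at h
  simp only [Matrix.conjTranspose_apply, Complex.star_def, Complex.mul_conj] at h
  exact_mod_cast h

namespace Diagonalizes

variable {U V : Matrix n n ℂ} {p q : n → ℝ} {ρ σ : Matrix n n ℂ}

lemma re_conj_apply (hρ : Diagonalizes U p ρ) (V : Matrix n n ℂ) (j : n) :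
    ((Vᴴ * ρ * V) j j).re = ∑ i, Complex.normSq ((Uᴴ * V) i j) * p i := by
  have h : Vᴴ * ρ * V = (Uᴴ * V)ᴴ * Matrix.diagonal (fun i => (p i : ℂ)) * (Uᴴ * V) := by
    rw [hρ.eq, Matrix.conjTranspose_mul, Matrix.conjTranspose_conjTranspose]
    simp only [mul_assoc]
  rw [h, Matrix.mul_apply, Complex.re_sum]
  refine Finset.sum_congr rfl fun i _ => ?_
  rw [Matrix.mul_diagonal, Matrix.conjTranspose_apply]
  simp [Complex.normSq_apply]; ring

end Diagonalizes

lemma log_two_mul_entropy {ρ : Matrix n n ℂ} (hρ : ρ.IsHermitian) :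
    ∃ U p, Diagonalizes U p ρ ∧ Real.log 2 * entropy ρ = -∑ i, p i * Real.log (p i) := by
  obtain ⟨U, p, hU, hf⟩ := exists_diagonalizes hρ
  refine ⟨U, p, hU, ?_⟩
  have h : ρ * cfc (Real.logb 2) ρ =
      U * Matrix.diagonal (fun i => ((p i * Real.logb 2 (p i) : ℝ) : ℂ)) * Uᴴ := by
    rw [hf, hU.eq]
    simp only [Complex.ofReal_mul, ← Matrix.diagonal_mul_diagonal]
    simp only [mul_assoc]
    rw [← mul_assoc Uᴴ, hU.left, one_mul]
  rw [entropy, h, trace_conj_diagonal hU.left, Complex.ofReal_re, mul_neg, Finset.mul_sum]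
  congr 1
  refine Finset.sum_congr rfl fun i _ => ?_
  rw [Real.logb]
  field_simp

/-- Integral representation of the relative entropy by resolvent divergences. -/
lemma tendsto_integral_resolventDiv {V : Matrix n n ℂ} {q : n → ℝ} {ρ σ : Matrix n n ℂ}
    (hρ : ρ.PosSemidef) (hσ : Diagonalizes V q σ) (hq : ∀ i, 0 ≤ q i)
    (hsupp : ∀ j, q j = 0 → ((Vᴴ * ρ * V) j j).re = 0) :
    (∀ T, 0 ≤ T → IntervalIntegrable (fun t => resolventDiv t ρ σ) volume 0 T) ∧
      Tendsto (fun T => (∫ t in (0 : ℝ)..T, resolventDiv t ρ σ) - Real.log (1 + T) * ρ.trace.re)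
        atTop (𝓝 (-(Real.log 2 * entropy ρ) -
          ∑ j, ((Vᴴ * ρ * V) j j).re * Real.log (q j))) := by
  obtain ⟨U, p, hU, hent⟩ := log_two_mul_entropy hρ.isHermitian
  have hp := hU.nonneg hρ
  set w : n → n → ℝ := fun i j => Complex.normSq ((Uᴴ * V) i j) with hw
  have hs : ∀ i j, q j = 0 → w i j * p i = 0 := fun i j hj => by
    have h := hsupp j hj
    rw [hU.re_conj_apply] at h
    exact (Finset.sum_eq_zero_iff_of_nonneg fun i _ =>
      mul_nonneg (Complex.normSq_nonneg _) (hp i)).1 h i (Finset.mem_univ i)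
  have hI := fun i j {T : ℝ} (hT : 0 ≤ T) => integral_resolvent (hp i) (hq j) (hs i j) hT
  -- The closed formula is available only for `t > 0`; the endpoint `0` does not affect the
  -- integrals.
  have heq : ∀ t ∈ Set.Ioi (0 : ℝ), ∑ i, ∑ j, w i j * (p i ^ 2 / (q j + t * p i)) =
      resolventDiv t ρ σ := fun t ht => (resolventDiv_eq hU hσ hp hq ht).symm
  have hint : ∀ T, 0 ≤ T → IntervalIntegrable
      (fun t => ∑ i, ∑ j, w i j * (p i ^ 2 / (q j + t * p i))) volume 0 T := fun T hT => by
    have := IntervalIntegrable.sum (μ := volume) (a := 0) (b := T) Finset.univ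
      (f := fun i t => ∑ j, w i j * (p i ^ 2 / (q j + t * p i))) fun i _ => by
        have := IntervalIntegrable.sum (μ := volume) (a := 0) (b := T) Finset.univ
          (f := fun j t => w i j * (p i ^ 2 / (q j + t * p i))) fun j _ => (hI i j hT).1
        simpa [Finset.sum_fn] using this
    simpa [Finset.sum_fn] using this
  have hsub : ∀ T : ℝ, 0 ≤ T → Set.uIoc 0 T ⊆ Set.Ioi 0 := fun T hT => by
    rw [Set.uIoc_of_le hT]
    exact Set.Ioc_subset_Ioi_self
  refine ⟨fun T hT => (hint T hT).congr fun t ht => heq t (hsub T hT ht), ?_⟩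
  have hval : ∀ T : ℝ, 0 ≤ T → (∫ t in (0 : ℝ)..T, resolventDiv t ρ σ) -
      Real.log (1 + T) * ρ.trace.re = ∑ i, ∑ j,
        (w i j * p i * (Real.log (q j + T * p i) - Real.log (q j)) -
          Real.log (1 + T) * (w i j * p i)) := fun T hT => by
    have htr : ρ.trace.re = ∑ i, ∑ j, w i j * p i := by
      rw [hU.trace_eq, Complex.ofReal_re]
      refine Finset.sum_congr rfl fun i _ => ?_
      rw [← Finset.sum_mul, sum_normSq_overlap hU.left hσ.right, one_mul]
    rw [← intervalIntegral.integral_congr_ae (ae_of_all _ fun t ht => heq t (hsub T hT ht)),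
      intervalIntegral.integral_finsetSum, htr, Finset.mul_sum, ← Finset.sum_sub_distrib]
    · refine Finset.sum_congr rfl fun i _ => ?_
      rw [intervalIntegral.integral_finsetSum fun j _ => (hI i j hT).1, Finset.mul_sum,
        ← Finset.sum_sub_distrib]
      exact Finset.sum_congr rfl fun j _ => by rw [(hI i j hT).2]
    · intro i _
      have := IntervalIntegrable.sum (μ := volume) (a := 0) (b := T) Finset.univ
          (f := fun j t => w i j * (p i ^ 2 / (q j + t * p i))) fun j _ => (hI i j hT).1
      simpa [Finset.sum_fn] using this
  have hlim : -(Real.log 2 * entropy ρ) - ∑ j, ((Vᴴ * ρ * V) j j).re * Real.log (q j) =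
      ∑ i, ∑ j, w i j * p i * (Real.log (p i) - Real.log (q j)) := by
    simp only [hU.re_conj_apply, Finset.sum_mul, mul_sub, Finset.sum_sub_distrib]
    rw [hent, neg_neg]
    congr 1
    · refine Finset.sum_congr rfl fun i _ => ?_
      rw [← Finset.sum_mul, ← Finset.sum_mul, sum_normSq_overlap hU.left hσ.right, one_mul]
    · exact Finset.sum_comm
  rw [hlim]
  refine Tendsto.congr' (f₁ := _) ?_ (tendsto_finsetSum _ fun i _ =>
    tendsto_finsetSum _ fun j _ => tendsto_log_affine (w := w i j) (hp i) (hq j))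
  filter_upwards [eventually_ge_atTop 0] with T hT
  exact (hval T hT).symm

end RelativeEntropy

/-! ### Mutual information, CMI and strong subadditivity -/

section MutualInformation

open MeasureTheory Filter Topology

variable {a b c n : Type*} [Fintype a] [Fintype b] [Fintype c] [Fintype n]
  [DecidableEq a] [DecidableEq b] [DecidableEq c] [DecidableEq n]

/-- A unitary on the traced-out factor disappears by cyclicity of the trace, while the operator on
the kept factor passes through the partial trace. -/
lemma traceRight_conj_kronecker (A : Matrix a a ℂ) {B : Matrix n n ℂ} (hB : B * Bᴴ = 1)
    (X : Matrix (a × n) (a × n) ℂ) :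
    traceRight ((A ⊗ₖ B)ᴴ * X * (A ⊗ₖ B)) = Aᴴ * traceRight X * A := by
  have h1 : ∀ Y : Matrix (a × n) (a × n) ℂ,
      traceRight (((1 : Matrix a a ℂ) ⊗ₖ B)ᴴ * Y * ((1 : Matrix a a ℂ) ⊗ₖ B)) = traceRight Y := by
    intro Y
    ext i j
    have hblock : (Matrix.of fun p q =>
        ((((1 : Matrix a a ℂ) ⊗ₖ B)ᴴ * Y * ((1 : Matrix a a ℂ) ⊗ₖ B)) (i, p) (j, q))) =
        Bᴴ * (Matrix.of fun p q => Y (i, p) (j, q)) * B := by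
      ext p q
      simp [Matrix.mul_apply, Fintype.sum_prod_type, Matrix.one_apply, Finset.sum_mul,
        apply_ite (starRingEnd ℂ), ite_mul]
    have := congrArg Matrix.trace hblock
    rw [Matrix.trace_mul_comm, ← mul_assoc, hB, one_mul] at this
    exact this
  have h2 : traceRight ((A ⊗ₖ (1 : Matrix n n ℂ))ᴴ * X * (A ⊗ₖ (1 : Matrix n n ℂ))) =
      Aᴴ * traceRight X * A := by
    ext i j
    simp only [traceRight, Matrix.mul_apply, Fintype.sum_prod_type, Matrix.one_apply,
      Matrix.conjTranspose_apply, Matrix.kroneckerMap_apply, Matrix.of_apply]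
    simp only [mul_ite, mul_one, mul_zero, apply_ite star, star_zero, ite_mul, zero_mul,
      Finset.sum_ite_eq', Finset.mem_univ, if_true, Finset.mul_sum,
      Finset.sum_mul]
    rw [Finset.sum_comm]
    refine Finset.sum_congr rfl fun _ _ => ?_
    rw [Finset.sum_comm]
  have h3 : A ⊗ₖ B = (A ⊗ₖ (1 : Matrix n n ℂ)) * ((1 : Matrix a a ℂ) ⊗ₖ B) := by
    rw [← Matrix.mul_kronecker_mul, mul_one, one_mul]
  rw [← h2, ← h1 ((A ⊗ₖ (1 : Matrix n n ℂ))ᴴ * X * (A ⊗ₖ (1 : Matrix n n ℂ))), h3,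
    Matrix.conjTranspose_mul]
  simp only [mul_assoc]

lemma traceLeft_conj_kronecker {A : Matrix a a ℂ} (hA : A * Aᴴ = 1) (B : Matrix n n ℂ)
    (X : Matrix (a × n) (a × n) ℂ) :
    traceLeft ((A ⊗ₖ B)ᴴ * X * (A ⊗ₖ B)) = Bᴴ * traceLeft X * B := by
  have h := traceRight_conj_kronecker B hA (X.submatrix (Equiv.prodComm n a) (Equiv.prodComm n a))
  have e : B ⊗ₖ A = (A ⊗ₖ B).submatrix (Equiv.prodComm n a) (Equiv.prodComm n a) := by
    ext x y
    simp [mul_comm]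
  rw [e, Matrix.conjTranspose_submatrix, Matrix.submatrix_mul_equiv,
    Matrix.submatrix_mul_equiv] at h
  exact h

lemma Diagonalizes.kronecker {U : Matrix a a ℂ} {V : Matrix n n ℂ} {p : a → ℝ} {q : n → ℝ}
    {ρ : Matrix a a ℂ} {σ : Matrix n n ℂ} (hρ : Diagonalizes U p ρ) (hσ : Diagonalizes V q σ) :
    Diagonalizes (U ⊗ₖ V) (fun x => p x.1 * q x.2) (ρ ⊗ₖ σ) where
  left := by
    rw [Matrix.conjTranspose_kronecker, ← Matrix.mul_kronecker_mul, hρ.left, hσ.left,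
      Matrix.one_kronecker_one]
  right := by
    rw [Matrix.conjTranspose_kronecker, ← Matrix.mul_kronecker_mul, hρ.right, hσ.right,
      Matrix.one_kronecker_one]
  eq := by
    have h : Matrix.diagonal (fun x : a × n => ((p x.1 * q x.2 : ℝ) : ℂ)) =
        Matrix.diagonal (fun i => (p i : ℂ)) ⊗ₖ Matrix.diagonal (fun i => (q i : ℂ)) := by
      rw [Matrix.diagonal_kronecker_diagonal]
      simp
    rw [h, Matrix.conjTranspose_kronecker, ← Matrix.mul_kronecker_mul,
      ← Matrix.mul_kronecker_mul, ← hρ.eq, ← hσ.eq]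

lemma diagonalizes_one : Diagonalizes (1 : Matrix n n ℂ) (fun _ => 1) 1 where
  left := by simp
  right := by simp
  eq := by simp

/-- The joint distribution of a bipartite state in a product basis diagonalizing the left
marginal. -/
lemma sum_re_conj_kronecker {ρ : Matrix (a × n) (a × n) ℂ} {U : Matrix a a ℂ} {p : a → ℝ}
    (hU : Diagonalizes U p (traceRight ρ)) {V : Matrix n n ℂ} (hV : V * Vᴴ = 1) (i : a) :
    ∑ j, (((U ⊗ₖ V)ᴴ * ρ * (U ⊗ₖ V)) (i, j) (i, j)).re = p i := by
  have h := congrFun (congrFun (traceRight_conj_kronecker U hV ρ) i) i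
  rw [hU.conj_eq, Matrix.diagonal_apply_eq] at h
  rw [← Complex.re_sum]
  exact (congrArg Complex.re h).trans (Complex.ofReal_re _)

lemma sum_re_conj_kronecker' {ρ : Matrix (a × n) (a × n) ℂ} {V : Matrix n n ℂ} {q : n → ℝ}
    (hV : Diagonalizes V q (traceLeft ρ)) {U : Matrix a a ℂ} (hU : U * Uᴴ = 1) (j : n) :
    ∑ i, (((U ⊗ₖ V)ᴴ * ρ * (U ⊗ₖ V)) (i, j) (i, j)).re = q j := by
  have h := congrFun (congrFun (traceLeft_conj_kronecker hU V ρ) j) j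
  rw [hV.conj_eq, Matrix.diagonal_apply_eq] at h
  rw [← Complex.re_sum]
  exact (congrArg Complex.re h).trans (Complex.ofReal_re _)

/-- Integral representation of the mutual information. -/
lemma tendsto_integral_mutualDiv {ρ : Matrix (a × n) (a × n) ℂ} (hρ : IsState ρ) :
    (∀ T, 0 ≤ T → IntervalIntegrable (fun t => mutualDiv (some t) ρ) volume 0 T) ∧
      Tendsto (fun T => (∫ t in (0 : ℝ)..T, mutualDiv (some t) ρ) - Real.log (1 + T))
        atTop (𝓝 (Real.log 2 *
          (entropy (traceRight ρ) + entropy (traceLeft ρ) - entropy ρ))) := by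
  obtain ⟨U, p, hU, hSU⟩ := log_two_mul_entropy hρ.traceRight.1.isHermitian
  obtain ⟨V, q, hV, hSV⟩ := log_two_mul_entropy hρ.traceLeft.1.isHermitian
  have hp := hU.nonneg hρ.traceRight.1
  have hq := hV.nonneg hρ.traceLeft.1
  -- The joint distribution of `ρ` in the product eigenbasis has marginals `p` and `q`. A zero of
  -- `p` or `q` therefore forces a zero of `r`: this is the support condition, and it makes `log (p
  -- q) = log p + log q` valid after multiplication by `r`.
  set r : a → n → ℝ := fun i j => (((U ⊗ₖ V)ᴴ * ρ * (U ⊗ₖ V)) (i, j) (i, j)).re with hr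
  have hr0 : ∀ i j, 0 ≤ r i j := fun i j =>
    (Complex.le_def.1 ((hρ.1.conjTranspose_mul_mul_same (U ⊗ₖ V)).diag_nonneg (i := (i, j)))).1
  have hrp : ∀ i, ∑ j, r i j = p i := sum_re_conj_kronecker hU hV.right
  have hrq : ∀ j, ∑ i, r i j = q j := sum_re_conj_kronecker' hV hU.right
  have hp0 : ∀ i j, p i = 0 → r i j = 0 := fun i j h =>
    (Finset.sum_eq_zero_iff_of_nonneg fun j _ => hr0 i j).1 ((hrp i).trans h) j (Finset.mem_univ j)
  have hq0 : ∀ i j, q j = 0 → r i j = 0 := fun i j h =>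
    (Finset.sum_eq_zero_iff_of_nonneg fun i _ => hr0 i j).1 ((hrq j).trans h) i (Finset.mem_univ i)
  have h := tendsto_integral_resolventDiv hρ.1 (hU.kronecker hV)
    (fun x => mul_nonneg (hp x.1) (hq x.2))
    (fun x hx => (mul_eq_zero.1 hx).elim (hp0 x.1 x.2) (hq0 x.1 x.2))
  refine ⟨h.1, ?_⟩
  have hlim : Real.log 2 * (entropy (traceRight ρ) + entropy (traceLeft ρ) - entropy ρ) =
      -(Real.log 2 * entropy ρ) - ∑ x : a × n,
        (((U ⊗ₖ V)ᴴ * ρ * (U ⊗ₖ V)) x x).re * Real.log (p x.1 * q x.2) := by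
    have e : ∑ x : a × n, (((U ⊗ₖ V)ᴴ * ρ * (U ⊗ₖ V)) x x).re * Real.log (p x.1 * q x.2) =
        ∑ i, p i * Real.log (p i) + ∑ j, q j * Real.log (q j) := by
      have e1 : ∀ i j, r i j * Real.log (p i * q j) =
          r i j * Real.log (p i) + r i j * Real.log (q j) := fun i j => by
        by_cases h1 : p i = 0
        · simp [hp0 i j h1]
        by_cases h2 : q j = 0
        · simp [hq0 i j h2]
        rw [Real.log_mul h1 h2, mul_add]
      rw [Fintype.sum_prod_type]
      change ∑ i, ∑ j, r i j * Real.log (p i * q j) = _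
      simp only [e1, Finset.sum_add_distrib]
      congr 1
      · simp only [← Finset.sum_mul, hrp]
      · rw [Finset.sum_comm]
        simp only [← Finset.sum_mul, hrq]
    rw [e, mul_sub, mul_add, hSU, hSV]
    ring
  rw [hlim]
  have h2 := h.2
  simp only [hρ.2, Complex.one_re, mul_one] at h2
  exact h2

/-- Integral representation of the conditional mutual information. -/
lemma tendsto_integral_condDiv {ρ : Matrix (a × b × c) (a × b × c) ℂ} (hρ : IsState ρ) :
    (∀ T, 0 ≤ T → IntervalIntegrable (fun t => condDiv (some t) ρ) volume 0 T) ∧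
      Tendsto (fun T => ∫ t in (0 : ℝ)..T, condDiv (some t) ρ) atTop
        (𝓝 (Real.log 2 * cmi ρ)) := by
  obtain ⟨h1, h2⟩ := tendsto_integral_mutualDiv hρ
  obtain ⟨h3, h4⟩ := tendsto_integral_mutualDiv hρ.margAB
  refine ⟨fun T hT => (h1 T hT).sub (h3 T hT), ?_⟩
  have h5 := h2.sub h4
  rw [traceRight_margAB, traceLeft_margAB, ← mul_sub] at h5
  have e : cmi ρ = entropy (traceRight ρ) + entropy (traceLeft ρ) - entropy ρ -
      (entropy (margA ρ) + entropy (margB ρ) - entropy (margAB ρ)) := by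
    rw [cmi, margA, margBC]; ring
  rw [e]
  refine h5.congr' ?_
  filter_upwards [eventually_ge_atTop 0] with T hT
  rw [show (fun t => condDiv (some t) ρ) = fun t => mutualDiv (some t) ρ -
    mutualDiv (some t) (margAB ρ) from rfl, intervalIntegral.integral_sub (h1 T hT) (h3 T hT)]
  ring

lemma cmi_le_of_condDiv_le {a' b' c' : Type*} [Fintype a'] [Fintype b'] [Fintype c']
    [DecidableEq a'] [DecidableEq b'] [DecidableEq c']
    {ρ : Matrix (a × b × c) (a × b × c) ℂ} {ρ' : Matrix (a' × b' × c') (a' × b' × c') ℂ}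
    (hρ : IsState ρ) (hρ' : IsState ρ') {η : ℝ}
    (h : ∀ t : ℝ, 0 < t → condDiv (some t) ρ' ≤ η * condDiv (some t) ρ) :
    cmi ρ' ≤ η * cmi ρ := by
  obtain ⟨h1, h2⟩ := tendsto_integral_condDiv hρ
  obtain ⟨h3, h4⟩ := tendsto_integral_condDiv hρ'
  have h5 : Real.log 2 * cmi ρ' ≤ η * (Real.log 2 * cmi ρ) := by
    refine le_of_tendsto_of_tendsto h4 (h2.const_mul η) ?_
    filter_upwards [eventually_ge_atTop 0] with T hT
    rw [← intervalIntegral.integral_const_mul]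
    exact intervalIntegral.integral_mono_on_of_le_Ioo hT (h3 T hT) ((h1 T hT).const_mul η)
      fun t ht => h t ht.1
  have h6 : 0 < Real.log 2 := Real.log_pos one_lt_two
  rw [mul_left_comm] at h5
  exact le_of_mul_le_mul_left h5 h6

lemma cmi_nonneg {ρ : Matrix (a × b × c) (a × b × c) ℂ} (hρ : IsState ρ) : 0 ≤ cmi ρ := by
  have h := (tendsto_integral_condDiv hρ).2
  have h1 : 0 ≤ Real.log 2 * cmi ρ := by
    refine ge_of_tendsto h ?_
    filter_upwards [eventually_ge_atTop 0] with T hT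
    refine intervalIntegral.integral_nonneg_of_ae_restrict hT ?_
    refine (ae_restrict_iff' measurableSet_Icc).2 ?_
    -- Nonnegativity of the integrand is known only for `t > 0`, so the endpoint is removed as a
    -- null set.
    filter_upwards [Measure.ae_ne volume (0 : ℝ)] with t ht0 ht
    exact condDiv_nonneg (fun s hs => by
      obtain rfl : t = s := by simpa using hs
      exact ht.1.lt_of_ne' ht0) hρ
  exact nonneg_of_mul_nonneg_right h1 (Real.log_pos one_lt_two)

/-- `ρ_AC ≤ d ρ_A ⊗ 1`, where `d` is the dimension of `C`. -/
lemma posSemidef_card_smul_kronecker_sub {ρ : Matrix (a × c) (a × c) ℂ} (hρ : ρ.PosSemidef) :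
    ((Fintype.card c : ℝ) • (traceRight ρ ⊗ₖ (1 : Matrix c c ℂ)) - ρ).PosSemidef := by
  set d : ℝ := (Fintype.card c : ℝ) with hd
  let g : c → c → c → ℂ := fun k l s => (if s = k then 1 else 0) - (if s = l then 1 else 0)
  let G : c → c → Matrix (a × c) (a × c) ℂ := fun k l => Matrix.diagonal fun x => g k l x.2
  let E : c → c → Matrix (a × c) (a × c) ℂ := fun k l => if k = l then 0 else
    (ρ.submatrix (fun i => (i, k)) (fun i => (i, k))) ⊗ₖ Matrix.single l l 1
  have hE : ∀ k l, (E k l).PosSemidef := fun k l => by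
    dsimp only [E]
    split_ifs
    · exact Matrix.PosSemidef.zero
    · refine (hρ.submatrix _).kronecker ?_
      rw [← Matrix.diagonal_single]
      exact Matrix.PosSemidef.diagonal (Pi.single_nonneg.2 zero_le_one)
  -- Two inequalities at once. With `G k l = 1 ⊗ (|k⟩⟨k| - |l⟩⟨l|)`, half the sum of `G ρ Gᴴ` is `d`
  -- times the pinching of `ρ` minus `ρ`; the `E k l` add up to `ρ_A ⊗ 1` minus the pinching.
  have key : d • (traceRight ρ ⊗ₖ (1 : Matrix c c ℂ)) - ρ =
      (1 / 2 : ℝ) • ∑ k, ∑ l, (G k l * ρ * (G k l)ᴴ + (2 * d) • E k l) := by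
    ext ⟨i, s⟩ ⟨j, u⟩
    have hg : ∀ k l, star (g k l u) = g k l u := fun k l => by
      dsimp only [g]; split_ifs <;> simp
    have hgg : ∑ k, ∑ l, g k l s * g k l u = 2 * d * (if s = u then 1 else 0) - 2 := by
      simp [g, mul_sub, Finset.sum_sub_distrib, hd]
      split_ifs <;> ring
    have hEs : ∑ k, ∑ l, E k l (i, s) (j, u) =
        (if s = u then 1 else 0) * (traceRight ρ i j - ρ (i, s) (j, u)) := by
      have : ∀ k l, E k l (i, s) (j, u) = (if s = u then 1 else 0) *
          ((if l = s then 1 else 0) * (ρ (i, k) (j, k) - if k = s then ρ (i, k) (j, k) else 0)) := by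
        intro k l
        dsimp only [E]
        by_cases hkl : k = l
        · subst hkl
          by_cases hks : k = s <;> simp [hks]
        · by_cases hls : l = s
          · subst hls
            by_cases hlu : l = u
            · subst hlu; simp [hkl]
            · simp [hkl, hlu]
          · simp [hkl, hls]
      simp only [this, ← Finset.mul_sum, ← Finset.sum_mul]
      by_cases hsu : s = u
      · subst hsu
        simp [traceRight]
      · simp [hsu]
    simp only [Matrix.smul_apply, Matrix.sub_apply, Matrix.sum_apply, Matrix.add_apply,
      Finset.sum_add_distrib, ← Finset.smul_sum, hEs, Matrix.kroneckerMap_apply, Matrix.one_apply]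
    have h1 : ∑ k, ∑ l, (G k l * ρ * (G k l)ᴴ) (i, s) (j, u) =
        (∑ k, ∑ l, g k l s * g k l u) * ρ (i, s) (j, u) := by
      simp only [Finset.sum_mul]
      refine Finset.sum_congr rfl fun k _ => Finset.sum_congr rfl fun l _ => ?_
      simp only [G, Matrix.diagonal_conjTranspose, Matrix.mul_diagonal, Matrix.diagonal_mul,
        Pi.star_apply, hg]
      ring
    rw [h1, hgg]
    simp only [Complex.real_smul]
    push_cast
    ring
  rw [key]
  refine Matrix.PosSemidef.smul (Matrix.posSemidef_sum _ fun k _ => Matrix.posSemidef_sum _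
    fun l _ => ?_) (by norm_num)
  exact (hρ.mul_mul_conjTranspose_same _).add ((hE k l).smul (by positivity))

end MutualInformation

/-! ### Dimension bounds for the initial values -/

section Bounds

open MeasureTheory Filter Topology

variable {a b c n : Type*} [Fintype a] [Fintype b] [Fintype c] [Fintype n]
  [DecidableEq a] [DecidableEq b] [DecidableEq c] [DecidableEq n]

lemma Diagonalizes.sum_eq_one {U : Matrix n n ℂ} {p : n → ℝ} {ρ : Matrix n n ℂ}
    (h : Diagonalizes U p ρ) (hρ : IsState ρ) : ∑ i, p i = 1 := by
  have := h.trace_eq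
  rw [hρ.2] at this
  exact_mod_cast this.symm

/-- A crude bound suffices: `-x log x ≤ 1 - x ≤ 1` for each eigenvalue. -/
lemma log_two_mul_entropy_le_card {ρ : Matrix n n ℂ} (hρ : IsState ρ) :
    Real.log 2 * entropy ρ ≤ Fintype.card n := by
  obtain ⟨U, p, hU, h⟩ := log_two_mul_entropy hρ.1.isHermitian
  rw [h, ← Finset.sum_neg_distrib, ← nsmul_one (Fintype.card n), ← Finset.card_univ]
  refine Finset.sum_le_card_nsmul _ _ _ fun i _ => ?_
  rcases (hU.nonneg hρ.1 i).eq_or_lt with h0 | h0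
  · simp [← h0]
  · have h1 := mul_le_mul_of_nonneg_left (Real.one_sub_inv_le_log_of_pos h0) h0.le
    rw [mul_sub, mul_inv_cancel₀ h0.ne'] at h1
    linarith

/-- The form decreases in `σ`, so `σ` may be replaced by the smaller `d⁻¹ • ρ`, which commutes with
`ρ` and gives `1 / (d⁻¹ + t)`. The bound is written as the integrand of `integral_resolvent` with `w
= p = 1`, `q = d⁻¹`. -/
lemma resolventDiv_le_of_posSemidef_smul_sub {ρ σ : Matrix n n ℂ} (hρ : IsState ρ)
    (hσ : σ.PosSemidef) {d : ℝ} (hd : 0 < d) (h : (d • σ - ρ).PosSemidef) {t : ℝ} (ht : 0 < t) :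
    resolventDiv t ρ σ ≤ 1 * (1 ^ 2 / (d⁻¹ + t * 1)) := by
  obtain ⟨U, p, hU, -⟩ := exists_diagonalizes hρ.1.isHermitian
  have hp := hU.nonneg hρ.1
  have hU' : Diagonalizes U (fun i => d⁻¹ * p i) (d⁻¹ • ρ) := by
    refine ⟨hU.left, hU.right, ?_⟩
    have e : Matrix.diagonal (fun i => ((d⁻¹ * p i : ℝ) : ℂ)) =
        d⁻¹ • Matrix.diagonal (fun i => (p i : ℂ)) := by
      rw [← Matrix.diagonal_smul]
      congr 1
      funext i
      simp
    rw [e, Matrix.mul_smul, Matrix.smul_mul, ← hU.eq]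
  have h1 : resolventDiv t ρ (d⁻¹ • ρ) = 1 * (1 ^ 2 / (d⁻¹ + t * 1)) := by
    rw [resolventDiv_eq hU hU' hp (fun i => mul_nonneg (inv_nonneg.2 hd.le) (hp i)) ht, hU.left]
    have e : ∀ i j, Complex.normSq ((1 : Matrix n n ℂ) i j) *
        (p i ^ 2 / (d⁻¹ * p j + t * p i)) = if i = j then p i * (1 / (d⁻¹ + t)) else 0 := by
      intro i j
      by_cases hij : i = j
      · subst hij
        rcases (hp i).eq_or_lt with h0 | h0
        · simp [← h0]
        · have : 0 < d⁻¹ := inv_pos.2 hd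
          rw [Matrix.one_apply_eq, map_one, if_pos rfl, one_mul, ← add_mul]
          field_simp
      · simp [hij]
    simp only [e, Finset.sum_ite_eq, Finset.mem_univ, if_true, ← Finset.sum_mul,
      hU.sum_eq_one hρ]
    ring
  rw [← h1]
  obtain ⟨Y, hY⟩ := (isGreatest_resolventDiv hρ.1 hσ ht).1
  refine le_trans ?_ ((isGreatest_resolventDiv hρ.1
    (hρ.1.smul (inv_nonneg.2 hd.le)) ht).2 ⟨Y, rfl⟩)
  rw [← hY, resolventForm, resolventForm]
  have h2 := (Complex.le_def.1
    ((h.smul (inv_nonneg.2 hd.le)).conjTranspose_mul_mul_same Y).trace_nonneg).1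
  rw [smul_sub, smul_smul, inv_mul_cancel₀ hd.ne', one_smul, mul_sub, sub_mul, Matrix.trace_sub,
    Complex.sub_re, Complex.zero_re] at h2
  linarith

/-- The left side is the relative entropy, in natural logarithms, of `ρ` to `ρ_A ⊗ 1`, and `ρ ≤ d
ρ_A ⊗ 1` bounds it by `log d`. -/
lemma entropy_traceRight_sub_entropy_le [Nonempty c] {ρ : Matrix (a × c) (a × c) ℂ}
    (hρ : IsState ρ) :
    Real.log 2 * (entropy (traceRight ρ) - entropy ρ) ≤ Real.log (Fintype.card c) := by
  obtain ⟨U, p, hU, hS⟩ := log_two_mul_entropy hρ.traceRight.1.isHermitian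
  have hp := hU.nonneg hρ.traceRight.1
  have hsum := fun i => sum_re_conj_kronecker hU (V := (1 : Matrix c c ℂ)) (by simp) i
  obtain ⟨hint, hlim⟩ := tendsto_integral_resolventDiv hρ.1
    (hU.kronecker (diagonalizes_one (n := c))) (fun x => mul_nonneg (hp x.1) zero_le_one)
    (fun x hx => by
      have hx' : p x.1 = 0 := by simpa using hx
      exact (Finset.sum_eq_zero_iff_of_nonneg fun j _ => (Complex.le_def.1
        ((hρ.1.conjTranspose_mul_mul_same (U ⊗ₖ (1 : Matrix c c ℂ))).diag_nonneg
          (i := (x.1, j)))).1).1 ((hsum x.1).trans hx') x.2 (Finset.mem_univ _))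
  have e : ∑ x : a × c, (((U ⊗ₖ (1 : Matrix c c ℂ))ᴴ * ρ * (U ⊗ₖ (1 : Matrix c c ℂ))) x x).re *
      Real.log (p x.1 * 1) = ∑ i, p i * Real.log (p i) := by
    rw [Fintype.sum_prod_type]
    simp only [mul_one, ← Finset.sum_mul, hsum]
  rw [e, hρ.2, ← neg_neg (∑ i, p i * Real.log (p i)), ← hS] at hlim
  have hd : (1 : ℝ) ≤ Fintype.card c := by exact_mod_cast Fintype.card_pos
  have hd0 : (0 : ℝ) < Fintype.card c := zero_lt_one.trans_le hd
  have hle : -(Real.log 2 * entropy ρ) - -(Real.log 2 * entropy (traceRight ρ)) ≤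
      Real.log (Fintype.card c) := by
    refine le_of_tendsto hlim ?_
    filter_upwards [eventually_ge_atTop 0] with T hT
    obtain ⟨h1, h2⟩ := integral_resolvent (w := 1) (p := 1) zero_le_one (inv_nonneg.2 hd0.le)
      (fun h => absurd h (inv_pos.2 hd0).ne') hT
    have h3 := intervalIntegral.integral_mono_on_of_le_Ioo hT (hint T hT) h1 fun t ht =>
      resolventDiv_le_of_posSemidef_smul_sub hρ (hρ.traceRight.1.kronecker Matrix.PosSemidef.one)
        hd0 (posSemidef_card_smul_kronecker_sub hρ.1) ht.1
    rw [h2, Real.log_inv] at h3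
    have h4 : Real.log ((Fintype.card c : ℝ)⁻¹ + T * 1) ≤ Real.log (1 + T) :=
      Real.log_le_log (by positivity) (by
        have := inv_le_one_of_one_le₀ hd
        linarith)
    rw [Complex.one_re]
    linarith
  linarith

/-- Subadditivity of the entropy. -/
lemma entropy_le_add {ρ : Matrix (a × n) (a × n) ℂ} (hρ : IsState ρ) :
    entropy ρ ≤ entropy (traceRight ρ) + entropy (traceLeft ρ) := by
  obtain ⟨hint, hlim⟩ := tendsto_integral_mutualDiv hρ
  have h : 0 ≤ Real.log 2 * (entropy (traceRight ρ) + entropy (traceLeft ρ) - entropy ρ) := by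
    refine ge_of_tendsto hlim ?_
    filter_upwards [eventually_ge_atTop 0] with T hT
    obtain ⟨h1, h2⟩ := integral_resolvent (w := 1) (p := 1) (q := 1) zero_le_one zero_le_one
      (fun h => absurd h one_ne_zero) hT
    have h3 := intervalIntegral.integral_mono_on_of_le_Ioo hT h1 (hint T hT) fun t ht => by
      have hσ := hρ.traceRight.kronecker hρ.traceLeft
      -- This test operator is optimal when the two states coincide. It gives the lower bound `1 /
      -- (1 + t)`, whose integral is the subtracted `log (1 + T)`.
      have h4 := (isGreatest_resolventDiv hρ.1 hσ.1 ht.1).2 ⟨(1 + t)⁻¹ • 1, rfl⟩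
      refine le_trans (le_of_eq ?_) h4
      have : 0 < 1 + t := by linarith [ht.1]
      simp only [resolventForm, Matrix.mul_smul, Matrix.smul_mul, mul_one, one_mul,
        Matrix.conjTranspose_smul, Matrix.conjTranspose_one, Matrix.trace_smul, hρ.2, hσ.2,
        Complex.smul_re, Complex.one_re, smul_eq_mul, star_trivial]
      field_simp
      ring
    rw [h2] at h3
    simp only [one_mul, mul_one, Real.log_one, sub_zero] at h3
    linarith
  linarith [nonneg_of_mul_nonneg_right h (Real.log_pos one_lt_two)]

/-- Subadditivity `S(AB) ≤ S(A) + S(B)` leaves `S(A) - S(ABC) + S(BC)`, which is bounded through the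
dimension of `BC` alone. Independence of `A` is essential, since `A` includes the first `n` sites of
the chain. -/
lemma cmi_le_card [Nonempty b] [Nonempty c] {ρ : Matrix (a × b × c) (a × b × c) ℂ}
    (hρ : IsState ρ) :
    cmi ρ ≤ (Real.log (Fintype.card (b × c)) + Fintype.card (b × c)) / Real.log 2 := by
  have h1 := entropy_le_add hρ.margAB
  rw [traceRight_margAB, traceLeft_margAB] at h1
  have h2 := entropy_traceRight_sub_entropy_le hρ
  have h3 := log_two_mul_entropy_le_card hρ.traceLeft
  have h4 : 0 < Real.log 2 := Real.log_pos one_lt_two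
  rw [le_div_iff₀ h4, cmi, margBC]
  have h5 := mul_le_mul_of_nonneg_left h1 h4.le
  rw [margA] at h5
  linarith

lemma cmiTraceNorm_le_two {ρ : Matrix (a × b × c) (a × b × c) ℂ} (hρ : IsState ρ) :
    cmiTraceNorm ρ ≤ 2 := by
  have hσ : IsState (margA ρ ⊗ₖ margBC ρ) := hρ.traceRight.kronecker hρ.traceLeft
  have h1 : traceNorm (ρ - margA ρ ⊗ₖ margBC ρ) ≤ _ := traceNorm_sub_le hρ.1 hσ.1
  rw [hρ.2, hσ.2, Complex.one_re] at h1
  have hτ : IsState (margA ρ ⊗ₖ margB ρ) := hρ.traceRight.kronecker hρ.traceLeft.traceRight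
  have h2 := traceNorm_nonneg (hρ.margAB.1.isHermitian.sub hτ.1.isHermitian)
  rw [cmiTraceNorm]
  linarith

end Bounds

/-! ### The chain states and exponential decay -/

section Chain

variable {h κ : Type*} [Fintype h] [DecidableEq h]

lemma isState_maxEntangled [Nonempty h] : IsState (maxEntangled h) := by
  have hd : (Fintype.card h : ℂ) ≠ 0 := by exact_mod_cast Fintype.card_ne_zero
  constructor
  · have e : maxEntangled h = (Fintype.card h : ℂ)⁻¹ • Matrix.vecMulVec
        (fun x : h × h => if x.1 = x.2 then (1 : ℂ) else 0)
        (star fun x : h × h => if x.1 = x.2 then (1 : ℂ) else 0) := by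
      ext x y
      by_cases h1 : x.1 = x.2 <;> by_cases h2 : y.1 = y.2 <;>
        simp [maxEntangled, Matrix.vecMulVec_apply, h1, h2]
    rw [e]
    exact (Matrix.posSemidef_vecMulVec_self_star _).smul
      (inv_nonneg.2 (by exact_mod_cast Nat.zero_le _))
  · simp [Matrix.trace, maxEntangled, Fintype.sum_prod_type, hd]

lemma IsState.reindex {m n : Type*} [Fintype m] [Fintype n] {ρ : Matrix m m ℂ} (hρ : IsState ρ)
    (e : n ≃ m) : IsState (ρ.submatrix e e) := (isChannel_reindexLM e.symm).isState hρ

/-- Splitting off the last entry of a tuple. -/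
def initLastEquiv (κ : Type*) (ℓ : ℕ) : (Fin (ℓ + 1) → κ) ≃ (Fin ℓ → κ) × κ where
  toFun s := (Fin.init s, s (Fin.last ℓ))
  invFun x := Fin.snoc x.1 x.2
  left_inv s := Fin.snoc_init_self s
  right_inv x := by simp

variable [Fintype κ] [DecidableEq κ] {N : Matrix h h ℂ →ₗ[ℂ] Matrix (κ × h) (κ × h) ℂ}

lemma isState_chain [Nonempty h] (hN : IsChannel N) (ℓ : ℕ) : IsState (chain N ℓ) := by
  induction ℓ with
  | zero =>
    exact isState_maxEntangled.reindex
      ((Equiv.refl h).prodCongr (Equiv.uniqueProd h (Fin 0 → κ)))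
  | succ ℓ ih =>
    exact (isState_applyOnC hN ih).reindex
      ((Equiv.refl h).prodCongr ((initLastEquiv κ ℓ).prodCongr (Equiv.refl h)))

/-- The chain `ρ_{n+m}` regrouped as an operator on `A B₁ ⋯ B_n`, `B_{n+1} ⋯ B_{n+m}` and
`C_{n+m}`. -/
def chainBipartition (N : Matrix h h ℂ →ₗ[ℂ] Matrix (κ × h) (κ × h) ℂ) (n m : ℕ) :
    Matrix ((h × (Fin n → κ)) × (Fin m → κ) × h) ((h × (Fin n → κ)) × (Fin m → κ) × h) ℂ :=
  (chain N (n + m)).submatrix (fun x => (x.1.1, Fin.append x.1.2 x.2.1, x.2.2))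
    (fun x => (x.1.1, Fin.append x.1.2 x.2.1, x.2.2))

lemma isState_chainBipartition [Nonempty h] (hN : IsChannel N) (n m : ℕ) :
    IsState (chainBipartition N n m) :=
  (isState_chain hN (n + m)).reindex
    { toFun := fun x => (x.1.1, Fin.append x.1.2 x.2.1, x.2.2)
      invFun := fun y => ((y.1, fun i => y.2.1 (Fin.castAdd m i)),
        (fun i => y.2.1 (Fin.natAdd n i)), y.2.2)
      left_inv := fun x => by simp
      right_inv := fun y => Prod.ext rfl (Prod.ext Fin.append_castAdd_natAdd rfl) }

lemma init_append {n m : ℕ} (u : Fin n → κ) (v : Fin (m + 1) → κ) :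
    Fin.init (n := n + m) (α := fun _ => κ) (Fin.append (m := n) (n := m + 1) u v) =
      Fin.append (m := n) (n := m) u (Fin.init v) := by
  conv_lhs => rw [← Fin.snoc_init_self v, Fin.append_snoc]
  exact Fin.init_snoc _ _

lemma append_last {n m : ℕ} (u : Fin n → κ) (v : Fin (m + 1) → κ) :
    Fin.append (m := n) (n := m + 1) u v (Fin.last (n + m)) = v (Fin.last m) :=
  Fin.append_right u v (Fin.last m)

lemma chain_succ_apply (ℓ : ℕ) (i j p q : h) (s t : Fin (ℓ + 1) → κ) :
    chain N (ℓ + 1) (i, s, p) (j, t, q) = applyOnC N (chain N ℓ)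
      (i, (Fin.init s, s (Fin.last ℓ)), p) (j, (Fin.init t, t (Fin.last ℓ)), q) := rfl

lemma chainBipartition_succ (n m : ℕ) :
    chainBipartition N n (m + 1) =
      idTensor (reindexLM ((initLastEquiv κ m).symm.prodCongr (Equiv.refl h)))
        (applyOnC N (chainBipartition N n m)) := by
  ext x y
  change chain N (n + m + 1) (x.1.1, Fin.append (m := n) (n := m + 1) x.1.2 x.2.1, x.2.2)
    (y.1.1, Fin.append (m := n) (n := m + 1) y.1.2 y.2.1, y.2.2) = _
  rw [chain_succ_apply, init_append, init_append, append_last, append_last]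
  rfl

/-- Each new site joins the conditioning system, so every step is an instance of the contraction;
the relabelling of the sites costs nothing because it can be undone on the conditioning system. -/
lemma condDiv_chainBipartition_le [Nonempty h]
    {F N' : Matrix h h ℂ →ₗ[ℂ] Matrix (κ × h) (κ × h) ℂ} {η : ℝ} (hη0 : 0 ≤ η) (hη1 : η ≤ 1)
    (hN : IsChannel N) (hF : IsForgetful F) (hN' : IsChannel N')
    (hdec : N = (1 - η) • F + η • N') {x : Option ℝ} (hx : ∀ t ∈ x, 0 < t) (n m : ℕ) :
    condDiv x (chainBipartition N n m) ≤ η ^ m * condDiv x (chainBipartition N n 0) := by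
  induction m with
  | zero => simp
  | succ m ih =>
    have hs := isState_chainBipartition hN n m
    have h1 := condDiv_applyOnC_le hx hη0 hη1 hN hF hN' hdec hs
    have h2 := condDiv_idTensor_le hx
      (isChannel_reindexLM ((initLastEquiv κ m).symm.prodCongr (Equiv.refl h)))
      (isChannel_reindexLM (initLastEquiv κ m)) (fun X => by
        ext i j
        simp [traceRight, reindexLM_apply]) (isState_applyOnC hN hs)
    rw [← chainBipartition_succ] at h2
    rw [pow_succ', mul_assoc]
    exact h2.trans (h1.trans (mul_le_mul_of_nonneg_left ih hη0))

lemma chainTripartite_zero (n m : ℕ) :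
    chainTripartite N n m 0 =
      idTensor (reindexLM ((Equiv.refl (Fin m → κ)).prodCongr
        (Equiv.uniqueProd h (Fin 0 → κ)).symm)) (chainBipartition N n m) := by
  ext x y
  change chain N (n + m)
    (x.1.1, Fin.append (n := 0) (Fin.append x.1.2 x.2.1) x.2.2.1, x.2.2.2)
    (y.1.1, Fin.append (n := 0) (Fin.append y.1.2 y.2.1) y.2.2.1, y.2.2.2) = _
  rw [Fin.append_right_nil _ _ rfl, Fin.append_right_nil _ _ rfl]
  rfl

/-- One step of the chain, acting on `B_{n+1} ⋯ B_{n+m}` and `B_{n+m+1} ⋯ B_{n+m+r} C`. -/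
def tailStepLM (N : Matrix h h ℂ →ₗ[ℂ] Matrix (κ × h) (κ × h) ℂ) (b : Type*) (r : ℕ) :
    Matrix (b × (Fin r → κ) × h) (b × (Fin r → κ) × h) ℂ →ₗ[ℂ]
      Matrix (b × (Fin (r + 1) → κ) × h) (b × (Fin (r + 1) → κ) × h) ℂ :=
  idTensorLM b (reindexLM ((initLastEquiv κ r).symm.prodCongr (Equiv.refl h)) ∘ₗ stepLM _ N)

lemma chainTripartite_succ (n m r : ℕ) :
    chainTripartite N n m (r + 1) =
      idTensor (tailStepLM N (Fin m → κ) r) (chainTripartite N n m r) := by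
  ext x y
  change chain N (n + m + r + 1)
    (x.1.1, Fin.append (m := n + m) (n := r + 1) (Fin.append x.1.2 x.2.1) x.2.2.1, x.2.2.2)
    (y.1.1, Fin.append (m := n + m) (n := r + 1) (Fin.append y.1.2 y.2.1) y.2.2.1, y.2.2.2) = _
  rw [chain_succ_apply, init_append, init_append, append_last, append_last]
  rfl

/-- Steps after `n + m` act only on the third system and leave the state on the conditioning sites
unchanged, so the recovery map is the identity. -/
lemma chainTripartite_bounds [Nonempty h] (hN : IsChannel N) (n m r : ℕ) :
    IsState (chainTripartite N n m r) ∧ ∀ x : Option ℝ, (∀ t ∈ x, 0 < t) →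
      condDiv x (chainTripartite N n m r) ≤ condDiv x (chainBipartition N n m) := by
  induction r with
  | zero =>
    have hs := isState_chainBipartition hN n m
    have hc := isChannel_reindexLM ((Equiv.refl (Fin m → κ)).prodCongr
      (Equiv.uniqueProd h (Fin 0 → κ)).symm)
    rw [chainTripartite_zero]
    refine ⟨hc.idTensorLM.isState hs, fun x hx => condDiv_idTensor_le hx hc
      (isChannel_reindexLM (Equiv.refl _)) (fun X => ?_) hs⟩
    ext i j
    simp [traceRight, reindexLM_apply, Fintype.sum_prod_type]
  | succ r ih =>
    have hc' := (isChannel_reindexLM ((initLastEquiv κ r).symm.prodCongr (Equiv.refl h))).comp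
      (isChannel_stepLM (b := Fin r → κ) hN)
    have hc : IsChannel (tailStepLM N (Fin m → κ) r) := hc'.idTensorLM
    rw [chainTripartite_succ]
    refine ⟨hc.idTensorLM.isState ih.1, fun x hx => (condDiv_idTensor_le hx hc
      (isChannel_reindexLM (Equiv.refl _)) (fun X => ?_) ih.1).trans (ih.2 x hx)⟩
    exact traceRight_idTensor hc' X

end Chain

end QChain

end

theorem mainTheorem4 {h κ : Type*} [Fintype h] [DecidableEq h] [Fintype κ] [DecidableEq κ]
    (N F N' : Matrix h h ℂ →ₗ[ℂ] Matrix (κ × h) (κ × h) ℂ) (η : ℝ)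
    (hη0 : 0 ≤ η) (hη1 : η < 1)
    (hN : QChain.IsChannel N) (hF : QChain.IsForgetful F) (hN' : QChain.IsChannel N')
    (hdec : N = (1 - η) • F + η • N') :
    (∀ (α β : Type*) [Fintype α] [DecidableEq α] [Fintype β] [DecidableEq β]
        (ρ : Matrix (α × β × h) (α × β × h) ℂ), QChain.IsState ρ →
          QChain.cmi (QChain.applyOnC N ρ) ≤ η * QChain.cmi ρ ∧
          QChain.cmiTraceNorm (QChain.applyOnC N ρ) ≤ η * QChain.cmiTraceNorm ρ) ∧
    ∃ K : ℝ, ∀ n m r : ℕ,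
      |QChain.cmi (QChain.chainTripartite N n m r)| ≤ K * η ^ m ∧
      |QChain.cmiTraceNorm (QChain.chainTripartite N n m r)| ≤ K * η ^ m := by
  open QChain in
  have hsome : ∀ {t : ℝ}, 0 < t → ∀ s ∈ some t, 0 < s := fun ht s hs => by
    rwa [← Option.some_inj.1 hs]
  have hnone : ∀ s ∈ (none : Option ℝ), 0 < s := fun s hs => by simp at hs
  refine ⟨fun α β _ _ _ _ ρ hρ => ⟨?_, ?_⟩, ?_⟩
  · exact cmi_le_of_condDiv_le hρ (isState_applyOnC hN hρ) fun t ht =>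
      condDiv_applyOnC_le (hsome ht) hη0 hη1.le hN hF hN' hdec hρ
  · rw [cmiTraceNorm_eq_condDiv, cmiTraceNorm_eq_condDiv]
    exact condDiv_applyOnC_le hnone hη0 hη1.le hN hF hN' hdec hρ
  -- Were `h` empty, the state `σ` would live on the zero space and have trace `0`.
  · have hne : Nonempty h := by
      obtain ⟨-, σ, hσ, -⟩ := hF
      by_contra hemp
      rw [not_nonempty_iff] at hemp
      have := hσ.2
      simp [Matrix.trace] at this
    -- The bound of `cmi_le_card` at `m = 0`: the conditioning system `Fin 0 → κ` is
    -- one-dimensional, so nothing depends on `n`. The `2` below serves the trace-norm quantity.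
    set K := (Real.log (Fintype.card ((Fin 0 → κ) × h)) + Fintype.card ((Fin 0 → κ) × h)) /
      Real.log 2
    refine ⟨max K 2, fun n m r => ?_⟩
    obtain ⟨hs, hle⟩ := chainTripartite_bounds hN n m r
    have hs0 := isState_chainBipartition hN n 0
    have hη : 0 ≤ η ^ m := pow_nonneg hη0 m
    have hle' : ∀ x : Option ℝ, (∀ t ∈ x, 0 < t) → condDiv x (chainTripartite N n m r) ≤
        η ^ m * condDiv x (chainBipartition N n 0) := fun x hx => (hle x hx).trans
      (condDiv_chainBipartition_le hη0 hη1.le hN hF hN' hdec hx n m)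
    constructor
    · rw [abs_of_nonneg (cmi_nonneg hs), mul_comm]
      exact (cmi_le_of_condDiv_le hs0 hs fun t ht => hle' _ (hsome ht)).trans
        (mul_le_mul_of_nonneg_left ((cmi_le_card hs0).trans (le_max_left _ _)) hη)
    · rw [cmiTraceNorm_eq_condDiv, abs_of_nonneg (condDiv_nonneg hnone hs), mul_comm]
      refine (hle' none hnone).trans (mul_le_mul_of_nonneg_left ?_ hη)
      rw [← cmiTraceNorm_eq_condDiv]
      exact (cmiTraceNorm_le_two hs0).trans (le_max_right _ _)
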